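/- Let $X$ be a connected smooth manifold (Hausdorff, second countable, without boundary), let $x\in X$, and let $Q$ be a finite quiver. For a category $\mathcal C$, let $\mathrm{Rep}(Q,\mathcal C)$ be the category of representations of $Q$ in $\mathcal C$: an object is a family of objects $V_i$ of $\mathcal C$ indexed by the vertices $i$ of $Q$ together with a morphism $\phi_a\colon V_{s(a)}\to V_{t(a)}$ for each arrow $a$, and a morphism $(V,\phi)\to(W,\psi)$ is a family of morphisms $f_i\colon V_i\to W_i$ with $f_{t(a)}\circ\phi_a=\psi_a\circ f_{s(a)}$ for every arrow $a$. For a group $G$, let $\mathrm{Rep}(G,\mathcal C)$ be the category whose objects are pairs $(V,\rho)$ of an object $V$ of $\mathcal C$ and a group homomorphism $\rho\colon G\to\mathrm{Aut}_{\mathcal C}(V)$, and whose morphisms $(V_1,\rho_1)\to(V_2,\rho_2)$ are the morphisms $f\colon V_1\to V_2$ of $\mathcal C$ with $f\circ\rho_1(g)=\rho_2(g)\circ f$ for all $g\in G$. Let $\mathbf{VSpace}$ be the category of finite-dimensional real vector spaces, and let $\mathbf{VB}(X)^{\mathrm F}$ be the category of flat vector bundles on $X$: an object is a smooth real vector bundle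 $\mathcal E$ of finite rank on $X$ with a smooth connection $\nabla$ of zero curvature, and a morphism $(\mathcal E,\nabla)\to(\mathcal E',\nabla')$ is a morphism of smooth vector bundles $\varphi\colon\mathcal E\to\mathcal E'$ over $\mathrm{id}_X$ with $\nabla'\circ\varphi=(\mathrm{id}_{T^*_X}\otimes\varphi)\circ\nabla$. Then there is an equivalence of categories $$\mathrm{Rep}\big(Q,\mathbf{VB}(X)^{\mathrm F}\big)\;\simeq\;\mathrm{Rep}\big(\pi_1(X,x),\mathrm{Rep}(Q,\mathbf{VSpace})\big),$$ that is, the category of flat $Q$-bundles on $X$ is equivalent to the category of representations of $\pi_1(X,x)$ in the category of finite-dimensional real representations of $Q$. -/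

import Mathlib

open CategoryTheory Bundle
open scoped Manifold ContDiff

universe u v w w'

/-! ### Representations of a quiver in a category -/

/-- A representation of the quiver `Q` in the category `C`: an object for every vertex and a
morphism for every arrow. -/
structure QuiverRep (Q : Type w) [Quiver.{w'} Q] (C : Type*) [Category* C] where
  /-- The object at a vertex. -/
  obj : Q → C
  /-- The morphism along an arrow. -/
  map : ∀ {i j : Q}, (i ⟶ j) → (obj i ⟶ obj j)

namespace QuiverRep

variable {Q : Type w} [Quiver.{w'} Q] {C : Type*} [Category* C]

/-- A morphism of representations of `Q`: a family of morphisms indexed by the vertices, making the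
square of every arrow commute. -/
@[ext]
structure Hom (V W : QuiverRep Q C) where
  /-- The component at a vertex. -/
  app : ∀ i : Q, V.obj i ⟶ W.obj i
  comm : ∀ {i j : Q} (a : i ⟶ j), V.map a ≫ app j = app i ≫ W.map a

/-- The category `Rep(Q, C)`. -/
instance : Category (QuiverRep Q C) where
  Hom V W := Hom V W
  id V := { app := fun i => 𝟙 (V.obj i), comm := fun a => by simp }
  comp f g :=
    { app := fun i => f.app i ≫ g.app i
      comm := fun a => by
        rw [← Category.assoc, f.comm a, Category.assoc, g.comm a, Category.assoc] }
  id_comp f := Hom.ext (funext fun _ => Category.id_comp _)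
  comp_id f := Hom.ext (funext fun _ => Category.comp_id _)
  assoc f g h := Hom.ext (funext fun _ => Category.assoc _ _ _)

end QuiverRep

/-! ### Smooth vector bundles and flat connections on a smooth manifold -/

/-- A smooth real vector bundle of finite rank over the `d`-dimensional smooth manifold `X`. -/
structure SmoothVB (d : ℕ) (X : Type u) [TopologicalSpace X]
    [ChartedSpace (EuclideanSpace ℝ (Fin d)) X] [IsManifold (𝓡 d) ∞ X] where
  /-- The rank of the bundle. -/
  rank : ℕ
  /-- The fibres of the bundle. -/
  fiber : X → Type v
  [addCommGroup : ∀ y, AddCommGroup (fiber y)]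
  [module : ∀ y, Module ℝ (fiber y)]
  [topFiber : ∀ y, TopologicalSpace (fiber y)]
  [topAddGroup : ∀ y, IsTopologicalAddGroup (fiber y)]
  [continuousSMul : ∀ y, ContinuousSMul ℝ (fiber y)]
  [topTotal : TopologicalSpace (TotalSpace (EuclideanSpace ℝ (Fin rank)) fiber)]
  [fiberBundle : FiberBundle (EuclideanSpace ℝ (Fin rank)) fiber]
  [vectorBundle : VectorBundle ℝ (EuclideanSpace ℝ (Fin rank)) fiber]
  [smoothBundle : ContMDiffVectorBundle ∞ (EuclideanSpace ℝ (Fin rank)) fiber (𝓡 d)]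

namespace SmoothVB

attribute [instance] addCommGroup module topFiber topAddGroup continuousSMul topTotal fiberBundle
  vectorBundle smoothBundle

variable {d : ℕ} {X : Type u} [TopologicalSpace X]
    [ChartedSpace (EuclideanSpace ℝ (Fin d)) X] [IsManifold (𝓡 d) ∞ X]

/-- The model fibre `ℝ^rank` of a vector bundle. -/
abbrev model (E : SmoothVB.{u, v} d X) : Type := EuclideanSpace ℝ (Fin E.rank)

/-- The total space of a vector bundle. -/
abbrev Total (E : SmoothVB.{u, v} d X) : Type (max u v) := TotalSpace E.model E.fiber

/-- A section `σ` of `E` is smooth. -/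
def IsSmoothSection (E : SmoothVB.{u, v} d X) (σ : ∀ y, E.fiber y) : Prop :=
  ContMDiff (𝓡 d) ((𝓡 d).prod 𝓘(ℝ, E.model)) ∞ (fun y => (⟨y, σ y⟩ : E.Total))

/-- A vector field on `X` is smooth. -/
def IsSmoothVectorField (Y : ∀ y : X, TangentSpace (𝓡 d) y) : Prop :=
  ContMDiff (𝓡 d) (𝓡 d).tangent ∞ (fun y => (⟨y, Y y⟩ : TangentBundle (𝓡 d) X))

/-- A morphism of smooth vector bundles over `X`: a fibrewise linear map over the identity of `X`
which is smooth as a map of total spaces. -/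
@[ext]
structure Hom (E E' : SmoothVB.{u, v} d X) where
  /-- The linear map on each fibre. -/
  app : ∀ y, E.fiber y →L[ℝ] E'.fiber y
  smooth : ContMDiff ((𝓡 d).prod 𝓘(ℝ, E.model)) ((𝓡 d).prod 𝓘(ℝ, E'.model)) ∞
    (fun p : E.Total => (⟨p.1, app p.1 p.2⟩ : E'.Total))

/-- The category `VB(X)` of smooth vector bundles over `X`. -/
instance : Category (SmoothVB.{u, v} d X) where
  Hom E E' := Hom E E'
  id E := { app := fun y => ContinuousLinearMap.id ℝ (E.fiber y), smooth := contMDiff_id }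
  comp f g :=
    { app := fun y => (g.app y).comp (f.app y)
      smooth := g.smooth.comp f.smooth }

/-- A connection `∇` on `E` is flat if its curvature
`R(Y, Z) σ = ∇_Y ∇_Z σ - ∇_Z ∇_Y σ - ∇_[Y, Z] σ` vanishes. Here `∇ σ y (Y y)` is the value of
`∇_Y σ` at the point `y`. -/
def IsFlat (E : SmoothVB.{u, v} d X) (nabla : CovariantDerivative (𝓡 d) E.model E.fiber) : Prop :=
  ∀ Y Z : ∀ y : X, TangentSpace (𝓡 d) y, IsSmoothVectorField Y → IsSmoothVectorField Z →
    ∀ σ : ∀ y, E.fiber y, E.IsSmoothSection σ → ∀ y : X,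
      nabla (fun z => nabla σ z (Z z)) y (Y y) - nabla (fun z => nabla σ z (Y z)) y (Z y)
        - nabla σ y (VectorField.mlieBracket (𝓡 d) Y Z y) = 0

end SmoothVB

/-- A flat vector bundle over `X`: a smooth vector bundle with a smooth flat connection. -/
structure FlatVB (d : ℕ) (X : Type u) [TopologicalSpace X]
    [ChartedSpace (EuclideanSpace ℝ (Fin d)) X] [IsManifold (𝓡 d) ∞ X] where
  /-- The underlying smooth vector bundle. -/
  bundle : SmoothVB.{u, v} d X
  /-- The connection. -/
  nabla : CovariantDerivative (𝓡 d) bundle.model bundle.fiber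
  smooth : CovariantDerivative.ContMDiffCovariantDerivative nabla ∞
  flat : bundle.IsFlat nabla

namespace FlatVB

variable {d : ℕ} {X : Type u} [TopologicalSpace X]
    [ChartedSpace (EuclideanSpace ℝ (Fin d)) X] [IsManifold (𝓡 d) ∞ X]

/-- A morphism of flat vector bundles: a morphism `φ` of smooth vector bundles compatible with the
connections, `∇' (φ σ) = (id ⊗ φ) (∇ σ)` for all smooth sections `σ`. -/
@[ext]
structure Hom (E E' : FlatVB.{u, v} d X) where
  /-- The underlying morphism of vector bundles. -/
  hom : E.bundle ⟶ E'.bundle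
  compatible : ∀ σ : ∀ y, E.bundle.fiber y, E.bundle.IsSmoothSection σ → ∀ y : X,
    E'.nabla (fun z => hom.app z (σ z)) y = (hom.app y).comp (E.nabla σ y)

/-- The category `VB(X)^F` of flat vector bundles over `X`. -/
instance : Category (FlatVB.{u, v} d X) where
  Hom E E' := Hom E E'
  id E := { hom := 𝟙 E.bundle, compatible := fun _ _ _ => rfl }
  comp f g :=
    { hom := f.hom ≫ g.hom
      compatible := fun σ hσ y => by
        have h := g.compatible (fun z => f.hom.app z (σ z)) (f.hom.smooth.comp hσ) y
        rw [f.compatible σ hσ y] at h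
        exact h }

end FlatVB

/-! A flat bundle amounts to a representation of the fundamental group on one fibre, and passing to
quiver representations is formal. The functor `FlatVB.monodromy` sends a flat bundle to its fibre
over `x` with parallel transport along loops; it is faithful, full and essentially surjective.
`QuiverRep.mapFunctor` carries this equivalence over to quiver representations, and
`QuiverRep.actionEquivalence` interchanges quiver and group, the two sides consisting of the same
data. An `Action` is a homomorphism into endomorphisms, which for a group automatically lands in
automorphisms.

The analytic core is the local existence of parallel frames, `FlatVB.exists_isFlatTriv`. In a frame
over a chart the connection is `d + A`, and zero curvature reads `∂_v (A w) - ∂_w (A v) + [A v, A w]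
= 0`. Under this condition `dG = -A G` has an invertible solution near every point (`exists_gauge`):
integrate along rays and compare neighbouring rays by Gronwall, the curvature condition removing the
first-order error.

Parallel frames differ by locally constant matrices, hence form a `LocalSystem`. With the discrete
topology on the model fibre this becomes a covering space, whose monodromy is homotopy invariant; it
serves as parallel transport. Morphisms of flat bundles correspond to families of linear maps that
are locally constant in parallel frames, equivalently that commute with transport. On a
path-connected base such a family is determined by its value at `x`, which can be any linear map
commuting with loops. This gives faithfulness and fullness.

For essential surjectivity, chosen paths from `x` extend a group representation to the fundamental
groupoid. Transport inside simply connected neighbourhoods trivializes it, so it becomes a local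
system, and the locally constant transition matrices glue to a smooth bundle. The exterior
derivatives in the frames glue to a connection, flat because `[Y, Z] f = Y Z f - Z Y f`. -/

/-! ### Induction on paths and monodromy of local systems -/

section LocalSystem

open Set Topology

/-- Induction on homotopy classes of paths: a property which is stable under concatenation and
holds for every path contained in a member of an open cover holds for all paths. -/
theorem Path.Homotopic.Quotient.induction_of_cover {X : Type*} [TopologicalSpace X]
    {U : X → Set X} (hU : ∀ c, IsOpen (U c)) (hmem : ∀ c, c ∈ U c)
    {P : ∀ {y z : X}, Path.Homotopic.Quotient y z → Prop}
    (htrans : ∀ {a b c : X} (p : Path.Homotopic.Quotient a b) (q : Path.Homotopic.Quotient b c),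
      P p → P q → P (p.trans q))
    (hshort : ∀ c {y z : X} (γ : Path y z), range γ ⊆ U c → P (.mk γ))
    {y z : X} (γ : Path.Homotopic.Quotient y z) : P γ := by
  obtain ⟨γ, rfl⟩ := Path.Homotopic.Quotient.mk_surjective γ
  obtain ⟨t, ht0, htm, ⟨n, hn⟩, ht⟩ :=
    exists_monotone_Icc_subset_open_cover_unitInterval (c := fun c => γ ⁻¹' U c)
      (fun c => (hU c).preimage γ.continuous)
      (fun s _ => mem_iUnion.2 ⟨γ s, hmem (γ s)⟩)
  -- The subdivision `t` cuts the path into short segments; initial pieces are assembled one segment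
  -- at a time, and `t n = 1` recovers the whole path.
  have key : ∀ k, P (.mk (γ.subpath (t 0) (t k))) := by
    intro k
    induction k with
    | zero =>
      refine hshort (γ (t 0)) _ ?_
      rw [Path.subpath_self]
      rintro _ ⟨s, rfl⟩
      exact hmem _
    | succ k ih =>
      obtain ⟨i, hi⟩ := ht k
      have h2 : P (.mk (γ.subpath (t k) (t (k + 1)))) := by
        refine hshort i _ ?_
        rw [Path.range_subpath_of_le _ _ _ (htm (Nat.le_succ k))]
        exact image_subset_iff.2 hi
      have h3 := htrans _ _ ih h2
      rw [← Path.Homotopic.Quotient.mk_trans] at h3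
      rwa [Path.Homotopic.Quotient.eq.2 ⟨Path.Homotopy.subpathTransSubpath γ _ _ _⟩] at h3
  have h1 := key n
  rw [hn n le_rfl, ht0, Path.subpath_zero_one] at h1
  have h2 : ∀ {a b : X} (ha : a = y) (hb : b = z), P (.mk (γ.cast ha hb)) → P (.mk γ) := by
    rintro _ _ rfl rfl h
    exact h
  exact h2 _ _ h1

/-- A local system on `X` with fibres `V y` and model `F`: an open neighbourhood `U c` of every
point `c` with a trivialization over it, such that the transition maps are locally constant. -/
structure LocalSystem (X : Type*) [TopologicalSpace X] (F : Type*) [AddCommGroup F] [Module ℝ F]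
    (V : X → Type*) [∀ y, AddCommGroup (V y)] [∀ y, Module ℝ (V y)] where
  /-- The domain of the trivialization around a point. -/
  U : X → Set X
  isOpen_U : ∀ c, IsOpen (U c)
  mem_U : ∀ c, c ∈ U c
  /-- The trivialization around a point; only its values over `U c` are relevant. -/
  T : X → ∀ y, V y ≃ₗ[ℝ] F
  locConst : ∀ c c' y, y ∈ U c → y ∈ U c' → ∀ᶠ z in 𝓝 y, ∀ u : F,
    T c' z ((T c z).symm u) = T c' y ((T c y).symm u)

/-! ### The covering space of a local system and its monodromy -/

/-- A type carrying the discrete topology. -/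
structure DiscreteCopy (F : Type*) where
  /-- The underlying element. -/
  val : F

/-- The wrapper keeps this topology apart from the Euclidean one that the model fibre has in the
applications. -/
instance (F : Type*) : TopologicalSpace (DiscreteCopy F) := ⊥

instance (F : Type*) : DiscreteTopology (DiscreteCopy F) := ⟨rfl⟩

namespace LocalSystem

variable {X : Type*} [TopologicalSpace X] {F : Type*} [AddCommGroup F] [Module ℝ F]
  {V : X → Type*} [∀ y, AddCommGroup (V y)] [∀ y, Module ℝ (V y)] (S : LocalSystem X F V)

/-- The covering space of a local system, as a fibre bundle with discrete fibre. -/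
def core : FiberBundleCore X X (DiscreteCopy F) where
  baseSet := S.U
  isOpen_baseSet := S.isOpen_U
  indexAt := id
  mem_baseSet_at := S.mem_U
  coordChange i j y u := ⟨S.T j y ((S.T i y).symm u.val)⟩
  coordChange_self i y _ v := by simp
  continuousOn_coordChange i j := by
    rintro ⟨y, u⟩ ⟨⟨hi, hj⟩, -⟩
    refine ContinuousAt.continuousWithinAt ?_
    -- Near `(y, u)` the second coordinate is frozen by discreteness and the transition map by
    -- `locConst`, so the coordinate change is locally constant.
    have h1 : ∀ᶠ p : X × DiscreteCopy F in 𝓝 (y, u),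
        (⟨S.T j p.1 ((S.T i p.1).symm p.2.val)⟩ : DiscreteCopy F) =
          ⟨S.T j y ((S.T i y).symm u.val)⟩ := by
      have h2 : ∀ᶠ v : DiscreteCopy F in 𝓝 u, v = u := by
        rw [nhds_discrete]; exact Filter.eventually_pure.2 rfl
      rw [nhds_prod_eq]
      filter_upwards [(S.locConst i j y hi hj).prod_mk h2] with p hp
      rw [hp.2, hp.1 u.val]
    exact (continuousAt_const (y := (⟨S.T j y ((S.T i y).symm u.val)⟩ : DiscreteCopy F))).congr
      (h1.mono fun _ h => h.symm)
  coordChange_comp i j k y _ v := by simp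

theorem isCoveringMap : IsCoveringMap (π (DiscreteCopy F) S.core.Fiber) :=
  FiberBundle.isCoveringMap

/-- The point of the covering space defined by a vector. -/
def point (y : X) (v : V y) : π (DiscreteCopy F) S.core.Fiber ⁻¹' {y} :=
  ⟨⟨y, (⟨S.T y y v⟩ : DiscreteCopy F)⟩, rfl⟩

/-- The vector defined by a point of the covering space. -/
def vector (y : X) (e : π (DiscreteCopy F) S.core.Fiber ⁻¹' {y}) : V y :=
  (S.T y y).symm (DiscreteCopy.val e.1.2)

theorem vector_point (y : X) (v : V y) : S.vector y (S.point y v) = v :=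
  LinearEquiv.symm_apply_apply _ _

theorem point_vector (y : X) (e : π (DiscreteCopy F) S.core.Fiber ⁻¹' {y}) :
    S.point y (S.vector y e) = e := by
  obtain ⟨⟨a, b⟩, h⟩ := e
  obtain rfl : a = y := h
  have h1 : S.T a a ((S.T a a).symm (DiscreteCopy.val b)) = DiscreteCopy.val b :=
    LinearEquiv.apply_symm_apply _ _
  refine Subtype.ext ?_
  exact congrArg (fun u : F => (⟨a, (⟨u⟩ : DiscreteCopy F)⟩ : S.core.TotalSpace)) h1

/-- Transport in a local system along a homotopy class of paths, as a map. -/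
noncomputable def transportFun {y z : X} (γ : Path.Homotopic.Quotient y z) (v : V y) : V z :=
  S.vector z (S.isCoveringMap.monodromy γ (S.point y v))

theorem transportFun_refl (y : X) (v : V y) : S.transportFun (.refl y) v = v := by
  rw [transportFun, IsCoveringMap.monodromy_refl, id, vector_point]

theorem transportFun_trans {y z w : X} (γ : Path.Homotopic.Quotient y z)
    (γ' : Path.Homotopic.Quotient z w) (v : V y) :
    S.transportFun (γ.trans γ') v = S.transportFun γ' (S.transportFun γ v) := by
  rw [transportFun, IsCoveringMap.monodromy_trans_apply, transportFun, transportFun, point_vector]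

/-- The path with constant coordinates in the trivialization around `c` lifts `γ` continuously, so
by uniqueness of lifts it computes the monodromy. -/
theorem transportFun_mk_of_subset {c y z : X} (γ : Path y z) (h : range γ ⊆ S.U c) (v : V y) :
    S.transportFun (.mk γ) v = (S.T c z).symm (S.T c y v) := by
  let e := S.core.localTriv c
  have hmem : ∀ t, γ t ∈ S.U c := fun t => h ⟨t, rfl⟩
  let Γ : unitInterval → S.core.TotalSpace := fun t =>
    e.toOpenPartialHomeomorph.symm (γ t, (⟨S.T c y v⟩ : DiscreteCopy F))
  have hΓ : ∀ t, Γ t = (S.point (γ t) ((S.T c (γ t)).symm (S.T c y v))).1 := fun t => rfl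
  have hc : Continuous Γ := by
    refine e.toOpenPartialHomeomorph.continuousOn_symm.comp_continuous
      (γ.continuous.prodMk continuous_const) fun t => ?_
    exact (e.mem_target).2 (hmem t)
  have h0 : Γ 0 = (S.point y v).1 := by
    rw [hΓ, γ.source, LinearEquiv.symm_apply_apply]
  have := (S.isCoveringMap.eq_liftPath_iff (γ := γ) (e := (S.point y v).1) (Γ := Γ)
    γ.source).2 ⟨hc, rfl, h0⟩
  have h1 : (S.isCoveringMap.monodromy (.mk γ) (S.point y v)) =
      S.point z ((S.T c z).symm (S.T c y v)) := by
    refine Subtype.ext ?_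
    have h2 : (S.isCoveringMap.monodromy (.mk γ) (S.point y v)).1 = Γ 1 := by rw [this]; rfl
    rw [h2, hΓ, γ.target]
  rw [transportFun, h1, vector_point]

/-- Covering theory only provides a map of sets. Linearity is visible on short paths, where
transport is a composite of trivializations, and survives concatenation. -/
theorem isLinearMap_transportFun {y z : X} (γ : Path.Homotopic.Quotient y z) :
    IsLinearMap ℝ (S.transportFun γ) := by
  refine Path.Homotopic.Quotient.induction_of_cover S.isOpen_U S.mem_U
    (P := fun γ => IsLinearMap ℝ (S.transportFun γ)) ?_ ?_ γ
  · intro a b c p q hp hq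
    constructor
    · intro v w
      simp only [transportFun_trans, hp.map_add, hq.map_add]
    · intro r v
      simp only [transportFun_trans, hp.map_smul, hq.map_smul]
  · intro c y z γ hγ
    constructor <;> intros <;> simp [S.transportFun_mk_of_subset γ hγ]

/-- Transport in a local system along a homotopy class of paths. -/
noncomputable def transport {y z : X} (γ : Path.Homotopic.Quotient y z) : V y →ₗ[ℝ] V z :=
  (S.isLinearMap_transportFun γ).mk' _

theorem transport_refl (y : X) (v : V y) : S.transport (.refl y) v = v :=
  S.transportFun_refl y v

theorem transport_trans {y z w : X} (γ : Path.Homotopic.Quotient y z)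
    (γ' : Path.Homotopic.Quotient z w) (v : V y) :
    S.transport (γ.trans γ') v = S.transport γ' (S.transport γ v) :=
  S.transportFun_trans γ γ' v

theorem transport_mk_of_subset {c y z : X} (γ : Path y z) (h : range γ ⊆ S.U c) (v : V y) :
    S.transport (.mk γ) v = (S.T c z).symm (S.T c y v) :=
  S.transportFun_mk_of_subset γ h v

end LocalSystem

end LocalSystem

/-! ### Integration of flat connection forms -/

section Gauge

open Set Metric Topology

variable {E 𝔸 : Type*} [NormedAddCommGroup E] [NormedSpace ℝ E]
  [NormedRing 𝔸] [NormedAlgebra ℝ 𝔸]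

/-- Existence of a solution of the linear equation `g' = -α g` with small coefficient. -/
theorem exists_linear_ode_solution [CompleteSpace 𝔸] {α : ℝ → 𝔸} (hα : ContinuousOn α (Icc 0 1))
    (hb : ∀ t ∈ Icc (0 : ℝ) 1, ‖α t‖ ≤ 1 / 2) :
    ∃ g : ℝ → 𝔸, g 0 = 1 ∧ (∀ t ∈ Icc (0 : ℝ) 1, HasDerivWithinAt g (-(α t * g t)) (Icc 0 1) t) ∧
      ∀ t ∈ Icc (0 : ℝ) 1, ‖g t‖ ≤ ‖(1 : 𝔸)‖ * Real.exp 1 := by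
  -- On the ball of radius `‖1‖` around `1` one has `‖x‖ ≤ 2 * ‖1‖`, so the coefficient bound `1 /
  -- 2` keeps the speed below `‖1‖` and the solution lives on all of `[0, 1]`.
  have hP : IsPicardLindelof (fun t x => -(α t * x)) (⟨0, by simp⟩ : Icc (0 : ℝ) 1) (1 : 𝔸)
      ‖(1 : 𝔸)‖₊ 0 ‖(1 : 𝔸)‖₊ 1 := by
    refine ⟨fun t ht => ?_, fun x _ => ?_, fun t ht x hx => ?_, ?_⟩
    · refine LipschitzOnWith.of_dist_le_mul fun x _ y _ => ?_
      rw [dist_eq_norm, dist_eq_norm, ← neg_sub_neg, neg_neg, neg_neg, ← mul_sub, norm_sub_rev x y]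
      refine (norm_mul_le _ _).trans (mul_le_mul_of_nonneg_right ?_ (norm_nonneg _))
      exact (hb t ht).trans (by norm_num)
    · exact (hα.mul continuousOn_const).neg
    · rw [norm_neg]
      have h1 : ‖x‖ ≤ ‖(1 : 𝔸)‖ + ‖(1 : 𝔸)‖ := by
        have := mem_closedBall_iff_norm.1 hx
        calc ‖x‖ = ‖(x - 1) + 1‖ := by simp
          _ ≤ _ := norm_add_le _ _
          _ ≤ _ := by simpa using this
      refine (norm_mul_le _ _).trans ?_
      have := mul_le_mul (hb t ht) h1 (norm_nonneg _) (by norm_num)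
      simp only [coe_nnnorm]
      linarith
    · simp
  obtain ⟨g, hg0, hg⟩ := hP.exists_eq_forall_mem_Icc_hasDerivWithinAt₀
  refine ⟨g, hg0, hg, fun t ht => ?_⟩
  have h1 := norm_le_gronwallBound_of_norm_deriv_right_le (f := g) (f' := fun t => -(α t * g t))
    (δ := ‖(1 : 𝔸)‖) (K := 1) (ε := 0) (a := 0) (b := 1)
    (fun t ht => (hg t ht).continuousWithinAt)
    (fun t ht => (hg t ⟨ht.1, ht.2.le⟩).mono_of_mem_nhdsWithin
      (Icc_mem_nhdsGE_of_mem ht)) (by rw [hg0])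
    (fun t ht => by
      rw [norm_neg, add_zero]
      refine (norm_mul_le _ _).trans (mul_le_mul_of_nonneg_right ?_ (norm_nonneg _))
      exact (hb t ⟨ht.1, ht.2.le⟩).trans (by norm_num)) t ht
  rw [gronwallBound_ε0] at h1
  refine h1.trans (mul_le_mul_of_nonneg_left (Real.exp_le_exp.2 ?_) (norm_nonneg _))
  linarith [ht.2]

/-- Quadratic estimate of a function with Lipschitz derivative. -/
theorem norm_taylor_one_le {H : Type*} [NormedAddCommGroup H] [NormedSpace ℝ H] {f : E → H}
    {s : Set E} (hs : Convex ℝ s) (hd : ∀ q ∈ s, DifferentiableAt ℝ f q) {L : ℝ} (hL0 : 0 ≤ L)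
    (hL : ∀ q ∈ s, ∀ q' ∈ s, ‖fderiv ℝ f q - fderiv ℝ f q'‖ ≤ L * ‖q - q'‖)
    {x y : E} (hx : x ∈ s) (hy : y ∈ s) :
    ‖f y - f x - fderiv ℝ f x (y - x)‖ ≤ L * ‖y - x‖ ^ 2 := by
  have hsub : segment ℝ x y ⊆ s := hs.segment_subset hx hy
  have := (convex_segment x y).norm_image_sub_le_of_norm_fderiv_le' (𝕜 := ℝ) (f := f)
    (φ := fderiv ℝ f x) (C := L * ‖y - x‖) (fun q hq => hd q (hsub hq))
    (fun q hq => (hL q (hsub hq) x hx).trans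
      (mul_le_mul_of_nonneg_left (norm_sub_le_of_mem_segment hq) hL0))
    (left_mem_segment ℝ x y) (right_mem_segment ℝ x y)
  rwa [mul_assoc, ← sq] at this

/-- This bounds the defect of a first-order guess for the solution along the ray of `p + h`. In the
application `a` and `a₂` are the values of `A` at `t • p` and `t • (p + h)`, and `D` is the
derivative of `A` at `t • p`. The first-order terms cancel by flatness; what remains is the Taylor
remainder (constant `L`), the variation of `A` applied to `h` (`M`) and products of two small
factors (`3 * M ^ 2`). -/
theorem norm_gauge_remainder_le {M L t : ℝ} (ht0 : 0 ≤ t) (ht1 : t ≤ 1) {a a₂ : E →L[ℝ] 𝔸}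
    {D : E →L[ℝ] E →L[ℝ] 𝔸} {p h : E} (hM0 : 0 ≤ M)
    (ha : ‖a‖ ≤ M) (hp : ‖p‖ ≤ 1) (hh : ‖h‖ ≤ 1) (hδ : ‖a₂ - a‖ ≤ M * ‖h‖)
    (hρ : ‖a₂ - a - t • D h‖ ≤ L * ‖h‖ ^ 2)
    (hflat : D p h - D h p + a p * a h - a h * a p = 0) :
    ‖-(a₂ (p + h) * (1 - t • a h)) + (a h + t • D p h) + (1 - t • a h) * a p‖ ≤
      (L + M + 3 * M ^ 2) * ‖h‖ ^ 2 := by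
  set δ := a₂ - a with hδ_def
  set ρ := δ - t • D h with hρ_def
  have ha2 : a₂ = a + δ := by rw [hδ_def]; abel
  have hDh : t • D h p = δ p - ρ p := by rw [hρ_def]; simp
  -- Flatness enters here: it exchanges the radial derivative `D p h` for `D h p`, which the
  -- increment `δ` controls, at the cost of a commutator.
  have hDp : t • D p h = δ p - ρ p - t • (a p * a h) + t • (a h * a p) := by
    have : D p h = D h p - a p * a h + a h * a p := by
      rw [← sub_eq_zero, ← hflat]; abel
    rw [this, smul_add, smul_sub, hDh]
  have key : -(a₂ (p + h) * (1 - t • a h)) + (a h + t • D p h) + (1 - t • a h) * a p =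
      -ρ p - δ h + t • ((a h + δ p + δ h) * a h) := by
    rw [hDp, ha2]
    simp only [map_add, add_apply, mul_sub, sub_mul, add_mul, mul_one, one_mul,
      mul_smul_comm, smul_mul_assoc, smul_add]
    abel
  rw [key]
  have hn := norm_nonneg h
  have h1 : ‖ρ p‖ ≤ L * ‖h‖ ^ 2 := by
    refine (ρ.le_opNorm p).trans ?_
    calc ‖ρ‖ * ‖p‖ ≤ ‖ρ‖ * 1 := mul_le_mul_of_nonneg_left hp (norm_nonneg _)
      _ ≤ _ := by rw [mul_one]; exact hρ
  have h2 : ‖δ h‖ ≤ M * ‖h‖ ^ 2 := by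
    refine (δ.le_opNorm h).trans ?_
    rw [sq, ← mul_assoc]
    exact mul_le_mul_of_nonneg_right hδ hn
  have h3 : ‖a h‖ ≤ M * ‖h‖ := (a.le_opNorm h).trans (mul_le_mul_of_nonneg_right ha hn)
  have h4 : ‖δ p‖ ≤ M * ‖h‖ := by
    refine (δ.le_opNorm p).trans ?_
    calc ‖δ‖ * ‖p‖ ≤ ‖δ‖ * 1 := mul_le_mul_of_nonneg_left hp (norm_nonneg _)
      _ ≤ _ := by rw [mul_one]; exact hδ
  have h5 : ‖δ h‖ ≤ M * ‖h‖ := by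
    refine (δ.le_opNorm h).trans ?_
    calc ‖δ‖ * ‖h‖ ≤ ‖δ‖ * 1 := mul_le_mul_of_nonneg_left hh (norm_nonneg _)
      _ ≤ _ := by rw [mul_one]; exact hδ
  have h6 : ‖t • ((a h + δ p + δ h) * a h)‖ ≤ 3 * M ^ 2 * ‖h‖ ^ 2 := by
    rw [norm_smul, Real.norm_of_nonneg ht0]
    have h7 : ‖(a h + δ p + δ h) * a h‖ ≤ (3 * (M * ‖h‖)) * (M * ‖h‖) := by
      refine (norm_mul_le _ _).trans (mul_le_mul ?_ h3 (norm_nonneg _) (by positivity))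
      exact norm_add₃_le.trans (by linarith)
    calc t * ‖(a h + δ p + δ h) * a h‖ ≤ 1 * ‖(a h + δ p + δ h) * a h‖ :=
          mul_le_mul_of_nonneg_right ht1 (norm_nonneg _)
      _ ≤ _ := by rw [one_mul]; refine h7.trans (le_of_eq ?_); ring
  calc ‖-ρ p - δ h + t • ((a h + δ p + δ h) * a h)‖
      ≤ ‖-ρ p‖ + ‖δ h‖ + ‖t • ((a h + δ p + δ h) * a h)‖ :=
        (norm_add_le _ _).trans (by gcongr; exact norm_sub_le _ _)
    _ ≤ L * ‖h‖ ^ 2 + M * ‖h‖ ^ 2 + 3 * M ^ 2 * ‖h‖ ^ 2 := by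
        rw [norm_neg]; gcongr
    _ = _ := by ring

/-- Solutions of the radial transport equation of a flat connection form solve the full transport
equation. -/
theorem exists_gauge_of_bounds [CompleteSpace 𝔸] {A : E → E →L[ℝ] 𝔸} {r M L : ℝ} (hr : 0 < r)
    (hr1 : r ≤ 1)
    (hM0 : 0 ≤ M) (hL0 : 0 ≤ L) (hMr : M * r ≤ 1 / 2)
    (hd : ∀ p ∈ ball (0 : E) r, DifferentiableAt ℝ A p)
    (hM : ∀ p ∈ ball (0 : E) r, ‖A p‖ ≤ M) (hM' : ∀ p ∈ ball (0 : E) r, ‖fderiv ℝ A p‖ ≤ M)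
    (hL : ∀ p ∈ ball (0 : E) r, ∀ q ∈ ball (0 : E) r,
      ‖fderiv ℝ A p - fderiv ℝ A q‖ ≤ L * ‖p - q‖)
    (hflat : ∀ p ∈ ball (0 : E) r, ∀ v w,
      fderiv ℝ A p v w - fderiv ℝ A p w v + A p v * A p w - A p w * A p v = 0) :
    ∃ G : E → 𝔸, G 0 = 1 ∧ ∀ p ∈ ball (0 : E) r,
      HasFDerivAt G (-((ContinuousLinearMap.mul ℝ 𝔸).flip (G p) ∘L A p)) p := by
  have hmem : ∀ p ∈ ball (0 : E) r, ∀ t ∈ Icc (0 : ℝ) 1, t • p ∈ ball (0 : E) r := by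
    intro p hp t ht
    rw [mem_ball_zero_iff] at hp ⊢
    rw [norm_smul, Real.norm_of_nonneg ht.1]
    exact (mul_le_of_le_one_left (norm_nonneg _) ht.2).trans_lt hp
  have hsmall : ∀ p ∈ ball (0 : E) r, ∀ t ∈ Icc (0 : ℝ) 1, ‖A (t • p) p‖ ≤ 1 / 2 := by
    intro p hp t ht
    refine ((A (t • p)).le_opNorm p).trans (le_trans ?_ hMr)
    exact mul_le_mul (hM _ (hmem p hp t ht)) (mem_ball_zero_iff.1 hp).le (norm_nonneg _) hM0
  have hderA : ∀ p ∈ ball (0 : E) r, ∀ t ∈ Icc (0 : ℝ) 1, ∀ v,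
      HasDerivAt (fun t : ℝ => A (t • p) v) (fderiv ℝ A (t • p) p v) t := by
    intro p hp t ht v
    have h1 : HasDerivAt (fun t : ℝ => t • p) p t := by
      simpa using (hasDerivAt_id t).smul_const p
    have h2 := (hd _ (hmem p hp t ht)).hasFDerivAt.comp_hasDerivAt t h1
    simpa using h2.clm_apply (hasDerivAt_const t v)
  have hsol : ∀ p ∈ ball (0 : E) r, ∃ g : ℝ → 𝔸, g 0 = 1 ∧
      (∀ t ∈ Icc (0 : ℝ) 1, HasDerivWithinAt g (-(A (t • p) p * g t)) (Icc 0 1) t) ∧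
      ∀ t ∈ Icc (0 : ℝ) 1, ‖g t‖ ≤ ‖(1 : 𝔸)‖ * Real.exp 1 := fun p hp =>
    exists_linear_ode_solution
      (fun t ht => (hderA p hp t ht p).continuousAt.continuousWithinAt) (hsmall p hp)
  choose! g hg0 hg hgb using hsol
  -- The gauge at `p` is the time-one value of the solution along the ray from `0` to `p`.
  refine ⟨fun p => g p 1, ?_, fun p hp => ?_⟩
  · have h0 : (0 : E) ∈ ball (0 : E) r := mem_ball_self hr
    have hc : ∀ t ∈ Icc (0 : ℝ) 1, g 0 t = g 0 0 := by
      refine constant_of_has_deriv_right_zero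
        (fun t ht => (hg 0 h0 t ht).continuousWithinAt) fun t ht => ?_
      have := (hg 0 h0 t ⟨ht.1, ht.2.le⟩).mono_of_mem_nhdsWithin (Icc_mem_nhdsGE_of_mem ht)
      simpa using this
    exact (hc 1 (by simp)).trans (hg0 0 h0)
  · set N := ‖(1 : 𝔸)‖ * Real.exp 1 with hN
    set C := (L + M + 3 * M ^ 2) * N with hC
    have hest : ∀ h : E, ‖h‖ ≤ 1 → p + h ∈ ball (0 : E) r →
        ‖g (p + h) 1 - g p 1 + A p h * g p 1‖ ≤ C * (Real.exp 1 - 1) * ‖h‖ ^ 2 := by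
      intro h hh hph
      -- `W` compares the solution along the ray of `p + h` with its expected first-order
      -- approximation. It starts at `0` and satisfies the ray equation with forcing term `R t * g p
      -- t` of order `‖h‖ ^ 2`, so Gronwall makes `W 1` quadratic in `h`. This is differentiability
      -- at `p`, without smooth dependence of solutions on parameters.
      let W : ℝ → 𝔸 := fun t => g (p + h) t - (1 - t • A (t • p) h) * g p t
      let R : ℝ → 𝔸 := fun t => -(A (t • (p + h)) (p + h) * (1 - t • A (t • p) h)) +
        (A (t • p) h + t • fderiv ℝ A (t • p) p h) + (1 - t • A (t • p) h) * A (t • p) p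
      have hW : ∀ t ∈ Icc (0 : ℝ) 1, HasDerivWithinAt W
          (-(A (t • (p + h)) (p + h) * W t) + R t * g p t) (Icc 0 1) t := by
        intro t ht
        have h1 : HasDerivAt (fun t : ℝ => (1 : 𝔸) - t • A (t • p) h)
            (-(t • fderiv ℝ A (t • p) p h + A (t • p) h)) t := by
          have := ((hasDerivAt_id t).smul (hderA p hp t ht h)).const_sub (1 : 𝔸)
          simpa using this
        have h2 := (hg (p + h) hph t ht).sub (h1.hasDerivWithinAt.mul (hg p hp t ht))
        refine h2.congr_deriv ?_
        simp only [W, R, mul_sub, sub_mul, add_mul, neg_mul, mul_neg, mul_one, one_mul, mul_assoc]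
        abel
      have hR : ∀ t ∈ Icc (0 : ℝ) 1, ‖R t‖ ≤ (L + M + 3 * M ^ 2) * ‖h‖ ^ 2 := by
        intro t ht
        have hx := hmem p hp t ht
        have hy := hmem (p + h) hph t ht
        have hyx : t • (p + h) - t • p = t • h := by rw [smul_add]; abel
        have hth : ‖t • h‖ ≤ ‖h‖ := by
          rw [norm_smul, Real.norm_of_nonneg ht.1]
          exact mul_le_of_le_one_left (norm_nonneg _) ht.2
        refine norm_gauge_remainder_le ht.1 ht.2 hM0 (hM _ hx)
          ((mem_ball_zero_iff.1 hp).le.trans hr1) hh ?_ ?_ (hflat _ hx p h)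
        · have := (convex_ball (0 : E) r).norm_image_sub_le_of_norm_fderiv_le (𝕜 := ℝ) hd hM' hx hy
          rw [hyx] at this
          exact this.trans (mul_le_mul_of_nonneg_left hth hM0)
        · have := norm_taylor_one_le (convex_ball (0 : E) r) hd hL0 hL hx hy
          rw [hyx, map_smul] at this
          exact this.trans (mul_le_mul_of_nonneg_left
            (pow_le_pow_left₀ (norm_nonneg _) hth 2) hL0)
      have hgr := norm_le_gronwallBound_of_norm_deriv_right_le (f := W)
        (f' := fun t => -(A (t • (p + h)) (p + h) * W t) + R t * g p t)
        (δ := 0) (K := 1) (ε := C * ‖h‖ ^ 2) (a := 0) (b := 1)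
        (fun t ht => (hW t ht).continuousWithinAt)
        (fun t ht => (hW t ⟨ht.1, ht.2.le⟩).mono_of_mem_nhdsWithin (Icc_mem_nhdsGE_of_mem ht))
        (by simp [W, hg0 p hp, hg0 (p + h) hph])
        (fun t ht => by
          have ht' : t ∈ Icc (0 : ℝ) 1 := ⟨ht.1, ht.2.le⟩
          refine (norm_add_le _ _).trans (add_le_add ?_ ?_)
          · rw [norm_neg]
            refine (norm_mul_le _ _).trans (mul_le_mul_of_nonneg_right ?_ (norm_nonneg _))
            exact (hsmall _ hph t ht').trans (by norm_num)
          · refine (norm_mul_le _ _).trans ?_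
            refine (mul_le_mul (hR t ht') (hgb p hp t ht') (norm_nonneg _) (by positivity)).trans ?_
            rw [hC]
            exact le_of_eq (by ring)) 1 (by simp)
      rw [gronwallBound_of_K_ne_0 one_ne_zero] at hgr
      have hW1 : W 1 = g (p + h) 1 - g p 1 + A p h * g p 1 := by
        simp only [W, one_smul, sub_mul, one_mul]; abel
      rw [hW1] at hgr
      refine hgr.trans (le_of_eq ?_)
      simp
      ring
    rw [hasFDerivAt_iff_isLittleO_nhds_zero]
    have hev : ∀ᶠ h in 𝓝 (0 : E), ‖h‖ ≤ 1 ∧ p + h ∈ ball (0 : E) r := by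
      refine Filter.Eventually.and ?_ ?_
      · filter_upwards [closedBall_mem_nhds (0 : E) one_pos] with h hh
        simpa using hh
      · have : ContinuousAt (fun h : E => p + h) 0 := by fun_prop
        exact this.eventually (isOpen_ball.mem_nhds (by simpa using hp))
    refine Asymptotics.IsBigO.trans_isLittleO (g := fun h : E => ‖h‖ ^ 2) ?_
      (Asymptotics.isLittleO_norm_pow_id one_lt_two)
    refine Asymptotics.IsBigO.of_bound (C * (Real.exp 1 - 1)) ?_
    filter_upwards [hev] with h hh
    have := hest h hh.1 hh.2
    simpa using this

/-- A function solving a linear total differential equation with smooth coefficients is smooth. -/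
theorem contDiffOn_of_hasFDerivAt_mul {A : E → E →L[ℝ] 𝔸} {G : E → 𝔸} {O : Set E} (hO : IsOpen O)
    (hA : ContDiffOn ℝ ∞ A O)
    (hG : ∀ p ∈ O, HasFDerivAt G (-((ContinuousLinearMap.mul ℝ 𝔸).flip (G p) ∘L A p)) p) :
    ContDiffOn ℝ ∞ G O := by
  rw [contDiffOn_infty]
  intro n
  induction n with
  | zero =>
    exact contDiffOn_zero.2 fun p hp => (hG p hp).continuousAt.continuousWithinAt
  | succ n ih =>
    -- Bootstrapping: if `G` is of class `C^n`, so is its derivative `-A G`, hence `G` is of class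
    -- `C^(n+1)`.
    have h1 : ContDiffOn ℝ n (fun p => -((ContinuousLinearMap.mul ℝ 𝔸).flip (G p) ∘L A p)) O :=
      (((ContinuousLinearMap.contDiff _).comp_contDiffOn ih).clm_comp
        (hA.of_le (by exact_mod_cast le_top))).neg
    push_cast
    rw [contDiffOn_succ_iff_fderiv_of_isOpen hO]
    refine ⟨fun p hp => (hG p hp).differentiableAt.differentiableWithinAt, by simp, ?_⟩
    exact h1.congr fun p hp => (hG p hp).fderiv

/-- Applied to the derivative of the connection form, this supplies the constants needed by
`exists_gauge_of_bounds`. -/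
theorem ContDiffAt.exists_bound_and_lipschitz {H : Type*} [NormedAddCommGroup H] [NormedSpace ℝ H]
    {f : E → H} {p₀ : E} (hf : ContDiffAt ℝ 1 f p₀) :
    ∃ K : ℝ, 0 ≤ K ∧ ∃ s ∈ 𝓝 p₀, (∀ p ∈ s, ‖f p‖ ≤ ‖f p₀‖ + 1) ∧
      ∀ p ∈ s, ∀ q ∈ s, ‖f p - f q‖ ≤ K * ‖p - q‖ := by
  obtain ⟨K, s, hs, hK⟩ := hf.exists_lipschitzOnWith
  refine ⟨K, K.2, _, Filter.inter_mem hs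
    (hf.continuousAt.norm.eventually (gt_mem_nhds (lt_add_one ‖f p₀‖))),
    fun p hp => hp.2.le, fun p hp q hq => hK.norm_sub_le hp.1 hq.1⟩

/-- A flat connection form `A` can be trivialized near every point by a gauge transformation `G`:
`dG = -A G`. -/
theorem exists_gauge [CompleteSpace 𝔸] {A : E → E →L[ℝ] 𝔸} {O : Set E} (hO : IsOpen O)
    {p₀ : E} (hp₀ : p₀ ∈ O) (hA : ContDiffOn ℝ ∞ A O)
    (hflat : ∀ p ∈ O, ∀ v w,
      fderiv ℝ A p v w - fderiv ℝ A p w v + A p v * A p w - A p w * A p v = 0) :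
    ∃ r > 0, ball p₀ r ⊆ O ∧ ∃ G : E → 𝔸, ContDiffOn ℝ ∞ G (ball p₀ r) ∧
      (∀ p ∈ ball p₀ r, IsUnit (G p)) ∧
      ∀ p ∈ ball p₀ r, ∀ v, fderiv ℝ G p v = -(A p v * G p) := by
  have hAt : ContDiffAt ℝ ∞ A p₀ := hA.contDiffAt (hO.mem_nhds hp₀)
  have hA' : ContDiffAt ℝ 1 (fderiv ℝ A) p₀ := hAt.fderiv_right (by norm_cast)
  obtain ⟨K, hK0, s, hs, hKb, hK⟩ := hA'.exists_bound_and_lipschitz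
  set M := max (‖A p₀‖ + 1) (‖fderiv ℝ A p₀‖ + 1) with hMdef
  have hM1 : 1 ≤ M := le_max_of_le_left (by linarith [norm_nonneg (A p₀)])
  have hM0 : 0 < M := by linarith
  have e1 : ∀ᶠ p in 𝓝 p₀, ‖A p‖ ≤ M := by
    have h1 : ContinuousAt (fun p => ‖A p‖) p₀ := hAt.continuousAt.norm
    filter_upwards [h1.eventually (gt_mem_nhds (lt_add_one ‖A p₀‖))] with p hp
    exact hp.le.trans (le_max_left _ _)
  have e2 : ∀ᶠ p in 𝓝 p₀, ‖fderiv ℝ A p‖ ≤ M := by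
    filter_upwards [hs] with p hp
    exact (hKb p hp).trans (le_max_right _ _)
  obtain ⟨ε, hε, hball⟩ := Metric.eventually_nhds_iff_ball.1
    (e1.and (e2.and ((hO.eventually_mem hp₀).and (Filter.eventually_of_mem hs fun p hp => hp))))
  -- The radius `1 / (2 * M)` makes the ray coefficient at most `1 / 2`; it is at most `1` because
  -- `M ≥ 1`.
  obtain ⟨r, hr0, hr1, hrM, hrε⟩ : ∃ r : ℝ, 0 < r ∧ r ≤ 1 ∧ M * r ≤ 1 / 2 ∧ r ≤ ε := by
    refine ⟨min (1 / (2 * M)) ε, lt_min (by positivity) hε, ?_, ?_, min_le_right _ _⟩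
    · refine (min_le_left _ _).trans ?_
      rw [div_le_one (by positivity)]; linarith
    · calc M * min (1 / (2 * M)) ε ≤ M * (1 / (2 * M)) :=
            mul_le_mul_of_nonneg_left (min_le_left _ _) hM0.le
        _ = 1 / 2 := by field_simp
  have hmem : ∀ q ∈ ball (0 : E) r, p₀ + q ∈ ball p₀ ε := by
    intro q hq
    rw [mem_ball_zero_iff] at hq
    simpa [mem_ball_iff_norm] using hq.trans_le hrε
  let B : E → E →L[ℝ] 𝔸 := fun q => A (p₀ + q)
  have hfB : ∀ q, fderiv ℝ B q = fderiv ℝ A (p₀ + q) := fun q => fderiv_comp_add_left p₀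
  have hdA : ∀ p ∈ O, DifferentiableAt ℝ A p := fun p hp =>
    (hA.contDiffAt (hO.mem_nhds hp)).differentiableAt (by simp)
  obtain ⟨G, hG0, hG⟩ := exists_gauge_of_bounds (A := B) (r := r) (M := M) (L := K) hr0 hr1 hM0.le
    hK0 hrM
    (fun q hq => by
      have := hdA _ (hball _ (hmem q hq)).2.2.1
      exact this.comp q (by fun_prop))
    (fun q hq => (hball _ (hmem q hq)).1)
    (fun q hq => by rw [hfB]; exact (hball _ (hmem q hq)).2.1)
    (fun q hq q' hq' => by
      rw [hfB, hfB]
      have := hK _ (hball _ (hmem q hq)).2.2.2 _ (hball _ (hmem q' hq')).2.2.2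
      rwa [add_sub_add_left_eq_sub] at this)
    (fun q hq v w => by rw [hfB]; exact hflat _ (hball _ (hmem q hq)).2.2.1 v w)
  let G' : E → 𝔸 := fun p => G (p - p₀)
  have hG' : ∀ p ∈ ball p₀ r,
      HasFDerivAt G' (-((ContinuousLinearMap.mul ℝ 𝔸).flip (G' p) ∘L A p)) p := by
    intro p hp
    have hq : p - p₀ ∈ ball (0 : E) r := by
      rw [mem_ball_zero_iff]; exact mem_ball_iff_norm.1 hp
    have h1 := (hG _ hq).comp p ((hasFDerivAt_id p).sub_const p₀)
    have h2 : B (p - p₀) = A p := by simp [B]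
    rw [h2] at h1
    exact h1
  have hc : ContinuousAt G' p₀ := (hG' p₀ (mem_ball_self hr0)).continuousAt
  -- `G'` is `1` at the centre and units form an open set, so a smaller ball gives invertibility.
  have hu : ∀ᶠ p in 𝓝 p₀, IsUnit (G' p) := by
    have : IsUnit (G' p₀) := by simp [G', hG0]
    exact hc.eventually (Units.isOpen.mem_nhds this)
  obtain ⟨ε', hε', hball'⟩ := Metric.eventually_nhds_iff_ball.1 hu
  have hsub : ball p₀ (min r ε') ⊆ ball p₀ r := ball_subset_ball (min_le_left _ _)
  have hsubO : ball p₀ r ⊆ O := fun p hp =>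
    (hball p (ball_subset_ball hrε hp)).2.2.1
  refine ⟨min r ε', lt_min hr0 hε', hsub.trans hsubO, G', ?_, ?_, ?_⟩
  · exact (contDiffOn_of_hasFDerivAt_mul isOpen_ball (hA.mono hsubO) hG').mono hsub
  · exact fun p hp => hball' p (ball_subset_ball (min_le_right _ _) hp)
  · intro p hp v
    rw [(hG' p (hsub hp)).fderiv]
    simp

end Gauge

/-! ### Local trivializations of smooth vector bundles -/

section LocalTriv

open Set Topology

variable {d : ℕ} {X : Type u} [TopologicalSpace X]
    [ChartedSpace (EuclideanSpace ℝ (Fin d)) X] [IsManifold (𝓡 d) ∞ X]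

/-- A smooth cut-off function around a point. -/
theorem exists_smooth_cutoff [T2Space X] {W : Set X} (hW : IsOpen W) {y : X} (hy : y ∈ W) :
    ∃ χ : X → ℝ, ContMDiff (𝓡 d) 𝓘(ℝ, ℝ) ∞ χ ∧ tsupport χ ⊆ W ∧ ∀ᶠ z in 𝓝 y, χ z = 1 := by
  obtain ⟨f, -, hf⟩ := (SmoothBumpFunction.nhds_basis_tsupport (I := 𝓡 d) y).mem_iff.1
    (hW.mem_nhds hy)
  exact ⟨f, f.contMDiff, hf, f.eventuallyEq_one⟩

namespace SmoothVB

instance (E : SmoothVB.{u, v} d X) :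
    ContMDiffVectorBundle 1 E.model E.fiber (𝓡 d) :=
  .of_le (n := ∞) (by norm_cast)

/-- A smooth trivialization of the vector bundle `E` over an open set `U`. -/
structure LocalTriv (E : SmoothVB.{u, v} d X) where
  /-- The domain. -/
  U : Set X
  isOpen_U : IsOpen U
  /-- The linear isomorphisms with the model fibre; only those over `U` are relevant. -/
  T : ∀ y, E.fiber y ≃L[ℝ] E.model
  contMDiffOn_T : ContMDiffOn ((𝓡 d).prod 𝓘(ℝ, E.model)) 𝓘(ℝ, E.model) ∞
    (fun p : E.Total => T p.1 p.2) (π E.model E.fiber ⁻¹' U)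
  contMDiffOn_symm : ContMDiffOn ((𝓡 d).prod 𝓘(ℝ, E.model)) ((𝓡 d).prod 𝓘(ℝ, E.model)) ∞
    (fun p : X × E.model => (⟨p.1, (T p.1).symm p.2⟩ : E.Total)) (U ×ˢ univ)

/-- Every fibre of a vector bundle is isomorphic to the model fibre. -/
noncomputable def fiberEquiv (E : SmoothVB.{u, v} d X) (y : X) : E.fiber y ≃L[ℝ] E.model :=
  (trivializationAt E.model E.fiber y).continuousLinearEquivAt ℝ y
    (FiberBundle.mem_baseSet_trivializationAt E.model E.fiber y)

open Classical in
/-- The smooth trivialization defined by a trivialization of the bundle atlas. -/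
noncomputable def LocalTriv.ofTrivialization (E : SmoothVB.{u, v} d X)
    (e : Trivialization E.model (π E.model E.fiber)) [MemTrivializationAtlas e] :
    LocalTriv E where
  U := e.baseSet
  isOpen_U := e.open_baseSet
  T y := if h : y ∈ e.baseSet then e.continuousLinearEquivAt ℝ y h else E.fiberEquiv y
  contMDiffOn_T := by
    have h1 := e.contMDiffOn (IB := 𝓡 d) (n := ∞)
    rw [e.source_eq] at h1
    refine (contMDiff_snd.comp_contMDiffOn h1).congr fun p hp => ?_
    have hp' : p.1 ∈ e.baseSet := hp
    simp only [hp', dif_pos]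
    rfl
  contMDiffOn_symm := by
    have h1 := e.contMDiffOn_symm (IB := 𝓡 d) (n := ∞)
    rw [e.target_eq] at h1
    refine h1.congr fun p hp => ?_
    have hp' : p.1 ∈ e.baseSet := hp.1
    simp only [hp', dif_pos]
    exact (e.symm_apply_eq_mk_continuousLinearEquivAt_symm p.1 hp' p.2).symm

theorem LocalTriv.ofTrivialization_T_apply (E : SmoothVB.{u, v} d X)
    (e : Trivialization E.model (π E.model E.fiber)) [MemTrivializationAtlas e] {y : X}
    (hy : y ∈ e.baseSet) (a : E.fiber y) : (LocalTriv.ofTrivialization E e).T y a = (e ⟨y, a⟩).2 := by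
  simp [ofTrivialization, hy]

/-- The smooth trivialization around a point given by the preferred bundle trivialization. -/
noncomputable def localTrivAt (E : SmoothVB.{u, v} d X) (c : X) : LocalTriv E :=
  .ofTrivialization E (trivializationAt E.model E.fiber c)

theorem mem_localTrivAt (E : SmoothVB.{u, v} d X) (c : X) : c ∈ (E.localTrivAt c).U :=
  FiberBundle.mem_baseSet_trivializationAt E.model E.fiber c

namespace LocalTriv

variable {E : SmoothVB.{u, v} d X} (t : LocalTriv E)

theorem contMDiffAt_T {p : E.Total} (hp : p.1 ∈ t.U) :
    ContMDiffAt ((𝓡 d).prod 𝓘(ℝ, E.model)) 𝓘(ℝ, E.model) ∞ (fun p : E.Total => t.T p.1 p.2) p :=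
  t.contMDiffOn_T.contMDiffAt
    ((t.isOpen_U.preimage (FiberBundle.continuous_proj E.model E.fiber)).mem_nhds hp)

theorem contMDiffAt_symm {y : X} (hy : y ∈ t.U) (u : E.model) :
    ContMDiffAt ((𝓡 d).prod 𝓘(ℝ, E.model)) ((𝓡 d).prod 𝓘(ℝ, E.model)) ∞
      (fun p : X × E.model => (⟨p.1, (t.T p.1).symm p.2⟩ : E.Total)) (y, u) :=
  t.contMDiffOn_symm.contMDiffAt ((t.isOpen_U.prod isOpen_univ).mem_nhds ⟨hy, mem_univ _⟩)

theorem contMDiffAt_section_iff {σ : ∀ y, E.fiber y} {y : X} (hy : y ∈ t.U) {n : ℕ∞ω}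
    (hn : n ≤ ∞) :
    ContMDiffAt (𝓡 d) ((𝓡 d).prod 𝓘(ℝ, E.model)) n (fun z => (⟨z, σ z⟩ : E.Total)) y ↔
      ContMDiffAt (𝓡 d) 𝓘(ℝ, E.model) n (fun z => t.T z (σ z)) y := by
  constructor
  · intro h
    exact ((t.contMDiffAt_T (p := ⟨y, σ y⟩) hy).of_le hn).comp y h
  · intro h
    have h1 := ((t.contMDiffAt_symm hy (t.T y (σ y))).of_le hn).comp y
      (contMDiffAt_id.prodMk h)
    refine h1.congr_of_eventuallyEq (Filter.Eventually.of_forall fun z => ?_)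
    simp

theorem mdifferentiableAt_section_iff {σ : ∀ y, E.fiber y} {y : X} (hy : y ∈ t.U) :
    MDifferentiableAt (𝓡 d) ((𝓡 d).prod 𝓘(ℝ, E.model)) (fun z => (⟨z, σ z⟩ : E.Total)) y ↔
      MDifferentiableAt (𝓡 d) 𝓘(ℝ, E.model) (fun z => t.T z (σ z)) y := by
  constructor
  · intro h
    exact ((t.contMDiffAt_T (p := ⟨y, σ y⟩) hy).mdifferentiableAt (by simp)).comp y h
  · intro h
    have h1 := ((t.contMDiffAt_symm hy (t.T y (σ y))).mdifferentiableAt (by simp)).comp y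
      (mdifferentiableAt_id.prodMk h)
    refine h1.congr_of_eventuallyEq (Filter.Eventually.of_forall fun z => ?_)
    simp

/-- A section given by a smooth function near a point extends to a global smooth section. -/
theorem exists_smooth_section [T2Space X] {W : Set X} (hW : IsOpen W) {y : X} (hy : y ∈ W)
    (hWU : W ⊆ t.U) {f : X → E.model} (hf : ContMDiffOn (𝓡 d) 𝓘(ℝ, E.model) ∞ f W) :
    ∃ σ : ∀ z, E.fiber z, E.IsSmoothSection σ ∧ ∀ᶠ z in 𝓝 y, t.T z (σ z) = f z := by
  obtain ⟨χ, hχ, hsupp, h1⟩ := exists_smooth_cutoff (d := d) hW hy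
  refine ⟨χ • fun z => (t.T z).symm (f z), ?_, ?_⟩
  · refine ContMDiffOn.smul_section_of_tsupport (n := ∞) (hχ.contMDiffOn (s := W)) hW hsupp ?_
    intro z hz
    refine ContMDiffAt.contMDiffWithinAt ?_
    rw [t.contMDiffAt_section_iff (hWU hz) le_rfl]
    simpa using hf.contMDiffAt (hW.mem_nhds hz)
  · filter_upwards [h1] with z hz
    simp [hz]

/-- The covariant derivative for which the trivialization is parallel. -/
noncomputable def flatCov (σ : ∀ y, E.fiber y) (y : X) : TangentSpace (𝓡 d) y →L[ℝ] E.fiber y :=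
  ((t.T y).symm : E.model →L[ℝ] E.fiber y) ∘L mvfderiv (𝓡 d) (fun z => t.T z (σ z)) y

/-- This is the reference connection on `t.U`; its difference from a given connection is tensorial
and defines the connection form. -/
theorem isCovariantDerivativeOn_flatCov :
    IsCovariantDerivativeOn E.model (I := 𝓡 d) t.flatCov t.U where
  add {σ σ' y} hσ hσ' hy := by
    have h1 := (t.mdifferentiableAt_section_iff hy).1 hσ
    have h2 := (t.mdifferentiableAt_section_iff hy).1 hσ'
    ext v
    simp only [flatCov, Pi.add_apply, map_add, mvfderiv_fun_add h1 h2]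
    simp
  leibniz {σ g y} hσ hg hy := by
    have h1 := (t.mdifferentiableAt_section_iff hy).1 hσ
    ext v
    simp only [flatCov, Pi.smul_apply', map_smul, mvfderiv_fun_smul hg h1]
    simp

end LocalTriv

end SmoothVB

end LocalTriv

/-! ### Coordinate vector fields -/

section CoordField

open Set Topology VectorField

section Generic

variable {E : Type*} [NormedAddCommGroup E] [NormedSpace ℝ E] {X : Type*} [TopologicalSpace X]
    [ChartedSpace E X] [IsManifold 𝓘(ℝ, E) ∞ X]

theorem isManifold_minSmoothness_three : IsManifold 𝓘(ℝ, E) (minSmoothness ℝ 3) X :=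
  .of_le (n := ∞) (by simp only [minSmoothness_of_isRCLikeNormedField]; norm_cast)

theorem isManifold_minSmoothness_two : IsManifold 𝓘(ℝ, E) (minSmoothness ℝ 2) X :=
  .of_le (n := ∞) (by simp only [minSmoothness_of_isRCLikeNormedField]; norm_cast)

/-- The constant vector field on a vector space. -/
def constField (w : E) (z : E) : TangentSpace 𝓘(ℝ, E) z := w

theorem contMDiffAt_constField (w z : E) : ContMDiffAt 𝓘(ℝ, E) 𝓘(ℝ, E).tangent ∞
    (fun z => (⟨z, constField w z⟩ : TangentBundle 𝓘(ℝ, E) E)) z := by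
  rw [contMDiffAt_vectorSpace_iff_contDiffAt]
  exact contDiffAt_const (c := w)

theorem mlieBracket_constField (v w z : E) :
    mlieBracket 𝓘(ℝ, E) (constField v) (constField w) z = 0 := by
  have h : lieBracketWithin ℝ (fun _ : E => v) (fun _ : E => w) univ z = 0 := by
    simp [lieBracketWithin]
  rw [← mlieBracketWithin_univ, mlieBracketWithin_eq_lieBracketWithin]
  exact h

/-- The derivative at `y` of the chart around `c`. -/
noncomputable def chartDeriv (c y : X) : TangentSpace 𝓘(ℝ, E) y →L[ℝ] E :=
  mfderiv 𝓘(ℝ, E) 𝓘(ℝ, E) (extChartAt 𝓘(ℝ, E) c) y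

/-- The coordinate vector field with constant components `w` in the chart around `c`. -/
noncomputable def coordField (c : X) (w : E) (y : X) : TangentSpace 𝓘(ℝ, E) y :=
  mpullback 𝓘(ℝ, E) 𝓘(ℝ, E) (extChartAt 𝓘(ℝ, E) c) (constField w) y

omit [IsManifold 𝓘(ℝ, E) ∞ X] in
theorem coordField_add (c : X) (w w' : E) (y : X) :
    coordField c (w + w') y = coordField c w y + coordField c w' y :=
  map_add (mfderiv 𝓘(ℝ, E) 𝓘(ℝ, E) (extChartAt 𝓘(ℝ, E) c) y).inverse w w'

omit [IsManifold 𝓘(ℝ, E) ∞ X] in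
theorem coordField_smul (c : X) (a : ℝ) (w : E) (y : X) :
    coordField c (a • w) y = a • coordField c w y :=
  map_smul (mfderiv 𝓘(ℝ, E) 𝓘(ℝ, E) (extChartAt 𝓘(ℝ, E) c) y).inverse a w

variable {c y : X} (hy : y ∈ (extChartAt 𝓘(ℝ, E) c).source)
include hy

theorem contMDiffAt_extChartAt_of_mem {n : ℕ∞ω} (hn : n ≤ ∞) :
    ContMDiffAt 𝓘(ℝ, E) 𝓘(ℝ, E) n (extChartAt 𝓘(ℝ, E) c) y :=
  ContMDiffAt.of_le (n := ∞) (contMDiffAt_extChartAt' (by rwa [extChartAt_source] at hy)) hn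

theorem mvfderiv_comp_extChartAt {H : Type*} [NormedAddCommGroup H] [NormedSpace ℝ H]
    {f : E → H} (hf : DifferentiableAt ℝ f (extChartAt 𝓘(ℝ, E) c y))
    (v : TangentSpace 𝓘(ℝ, E) y) :
    mvfderiv 𝓘(ℝ, E) (fun z => f (extChartAt 𝓘(ℝ, E) c z)) y v =
      fderiv ℝ f (extChartAt 𝓘(ℝ, E) c y) (chartDeriv c y v) := by
  have h := mfderiv_comp y hf.mdifferentiableAt
    ((contMDiffAt_extChartAt_of_mem hy (n := 1) (by norm_cast)).mdifferentiableAt (by simp))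
  have h2 := congrArg (fun L => L v) h
  rw [mfderiv_eq_fderiv] at h2
  exact h2

/-- Differentiability in a chart. -/
theorem contMDiffAt_iff_chart {H : Type*} [NormedAddCommGroup H] [NormedSpace ℝ H] {f : X → H}
    {n : ℕ∞ω} (hn : n ≤ ∞) :
    ContMDiffAt 𝓘(ℝ, E) 𝓘(ℝ, H) n f y ↔
      ContDiffAt ℝ n (fun p => f ((extChartAt 𝓘(ℝ, E) c).symm p)) (extChartAt 𝓘(ℝ, E) c y) := by
  have : IsManifold 𝓘(ℝ, E) n X := .of_le hn
  rw [contMDiffAt_iff_source_of_mem_source (x := c) (by rwa [extChartAt_source] at hy)]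
  simp only [modelWithCornersSelf_coe, range_id, contMDiffWithinAt_univ,
    contMDiffAt_iff_contDiffAt]
  rfl

omit [IsManifold 𝓘(ℝ, E) ∞ X] in
theorem eventuallyEq_comp_extChartAt {H : Type*} (f : X → H) :
    ∀ᶠ z in 𝓝 y, f ((extChartAt 𝓘(ℝ, E) c).symm (extChartAt 𝓘(ℝ, E) c z)) = f z := by
  filter_upwards [(isOpen_extChartAt_source c).mem_nhds hy] with z hz
  rw [(extChartAt 𝓘(ℝ, E) c).left_inv hz]

theorem chartDeriv_coordField (w : E) : chartDeriv c y (coordField c w y) = w :=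
  (isInvertible_mfderiv_extChartAt hy).self_apply_inverse w

theorem coordField_chartDeriv (v : TangentSpace 𝓘(ℝ, E) y) :
    coordField c (chartDeriv c y v) y = v :=
  (isInvertible_mfderiv_extChartAt hy).inverse_apply_self v

variable [CompleteSpace E]

theorem contMDiffAt_coordField (w : E) :
    ContMDiffAt 𝓘(ℝ, E) 𝓘(ℝ, E).tangent ∞
      (fun z => (⟨z, coordField c w z⟩ : TangentBundle 𝓘(ℝ, E) X)) y :=
  ContMDiffAt.mpullback_vectorField_preimage (n := ∞) (contMDiffAt_constField w _)
    (contMDiffAt_extChartAt_of_mem hy le_rfl) (isInvertible_mfderiv_extChartAt hy) (by norm_cast)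

/-- Lie brackets are natural under pullback along the chart, and constant fields commute. -/
theorem mlieBracket_coordField (v w : E) :
    mlieBracket 𝓘(ℝ, E) (coordField (X := X) c v) (coordField c w) y = 0 := by
  have := isManifold_minSmoothness_three (E := E) (X := X)
  have := isManifold_minSmoothness_two (E := E) (X := X)
  have hV : ∀ w : E, MDifferentiableAt 𝓘(ℝ, E) 𝓘(ℝ, E).tangent
      (fun z : E => (⟨z, constField w z⟩ : TangentBundle 𝓘(ℝ, E) E)) (extChartAt 𝓘(ℝ, E) c y) :=
    fun w => (contMDiffAt_constField w _).mdifferentiableAt (by simp)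
  have h := mpullback_mlieBracket (I := 𝓘(ℝ, E)) (n := ∞) (hV v) (hV w)
    (contMDiffAt_extChartAt_of_mem hy le_rfl)
    (by simp only [minSmoothness_of_isRCLikeNormedField]; norm_cast)
  refine h.symm.trans ?_
  rw [mpullback_apply, mlieBracket_constField, map_zero]

end Generic

variable {d : ℕ} {X : Type u} [TopologicalSpace X]
    [ChartedSpace (EuclideanSpace ℝ (Fin d)) X] [IsManifold (𝓡 d) ∞ X]

/-- Coordinate vector fields extend to global smooth vector fields. -/
theorem exists_smooth_vectorField [T2Space X] (c : X) {W : Set X} (hW : IsOpen W) {y : X}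
    (hy : y ∈ W) (hWs : W ⊆ (extChartAt (𝓡 d) c).source) (w : EuclideanSpace ℝ (Fin d)) :
    ∃ Y : ∀ z : X, TangentSpace (𝓡 d) z, SmoothVB.IsSmoothVectorField Y ∧
      ∀ᶠ z in 𝓝 y, Y z = coordField c w z := by
  obtain ⟨χ, hχ, hsupp, h1⟩ := exists_smooth_cutoff (d := d) hW hy
  refine ⟨χ • coordField c w, ?_, ?_⟩
  · refine ContMDiffOn.smul_section_of_tsupport (n := ∞) (hχ.contMDiffOn (s := W)) hW hsupp ?_
    exact fun z hz => (contMDiffAt_coordField (hWs hz) w).contMDiffWithinAt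
  · filter_upwards [h1] with z hz
    simp [hz]

end CoordField

section ChartDifferentiable

open Set Topology

variable {E : Type*} [NormedAddCommGroup E] [NormedSpace ℝ E] {X : Type*} [TopologicalSpace X]
    [ChartedSpace E X] [IsManifold 𝓘(ℝ, E) ∞ X] {c y : X}
    {H : Type*} [NormedAddCommGroup H] [NormedSpace ℝ H] {f : X → H}

theorem differentiableAt_comp_extChartAt_symm (hy : y ∈ (extChartAt 𝓘(ℝ, E) c).source)
    (hf : MDifferentiableAt 𝓘(ℝ, E) 𝓘(ℝ, H) f y) :
    DifferentiableAt ℝ (fun p => f ((extChartAt 𝓘(ℝ, E) c).symm p)) (extChartAt 𝓘(ℝ, E) c y) := by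
  have h1 : ContMDiffAt 𝓘(ℝ, E) 𝓘(ℝ, E) ∞ (extChartAt 𝓘(ℝ, E) c).symm (extChartAt 𝓘(ℝ, E) c y) :=
    (contMDiffOn_extChartAt_symm c).contMDiffAt
      ((isOpen_extChartAt_target c).mem_nhds ((extChartAt 𝓘(ℝ, E) c).map_source hy))
  have h2 : MDifferentiableAt 𝓘(ℝ, E) 𝓘(ℝ, H) f
      ((extChartAt 𝓘(ℝ, E) c).symm (extChartAt 𝓘(ℝ, E) c y)) := by
    rwa [(extChartAt 𝓘(ℝ, E) c).left_inv hy]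
  exact (h2.comp _ (h1.mdifferentiableAt (by simp))).differentiableAt

theorem mvfderiv_eq_fderiv_chart (hy : y ∈ (extChartAt 𝓘(ℝ, E) c).source)
    (hf : MDifferentiableAt 𝓘(ℝ, E) 𝓘(ℝ, H) f y) (v : TangentSpace 𝓘(ℝ, E) y) :
    mvfderiv 𝓘(ℝ, E) f y v =
      fderiv ℝ (fun p => f ((extChartAt 𝓘(ℝ, E) c).symm p)) (extChartAt 𝓘(ℝ, E) c y)
        (chartDeriv c y v) := by
  rw [← mvfderiv_comp_extChartAt hy (differentiableAt_comp_extChartAt_symm hy hf)]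
  have h : f =ᶠ[𝓝 y] fun z => f ((extChartAt 𝓘(ℝ, E) c).symm (extChartAt 𝓘(ℝ, E) c z)) :=
    (eventuallyEq_comp_extChartAt hy f).mono fun _ h => h.symm
  have h2 := congrArg (fun L => L v) (h.mfderiv_eq (I := 𝓘(ℝ, E)) (I' := 𝓘(ℝ, H)))
  exact h2

omit [IsManifold 𝓘(ℝ, E) ∞ X] in
theorem mvfderiv_congr {f g : X → H} (h : ∀ᶠ z in 𝓝 y, f z = g z) :
    mvfderiv 𝓘(ℝ, E) f y = mvfderiv 𝓘(ℝ, E) g y := by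
  have h' : f =ᶠ[𝓝 y] g := h
  ext v
  exact congrArg (fun L => L v) (h'.mfderiv_eq (I := 𝓘(ℝ, E)) (I' := 𝓘(ℝ, H)))

theorem mvfderiv_clm_comp {H' : Type*} [NormedAddCommGroup H'] [NormedSpace ℝ H'] (M : H →L[ℝ] H')
    (hf : MDifferentiableAt 𝓘(ℝ, E) 𝓘(ℝ, H) f y) (v : TangentSpace 𝓘(ℝ, E) y) :
    mvfderiv 𝓘(ℝ, E) (fun z => M (f z)) y v = M (mvfderiv 𝓘(ℝ, E) f y v) := by
  have hMf : MDifferentiableAt 𝓘(ℝ, E) 𝓘(ℝ, H') (fun z => M (f z)) y :=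
    M.mdifferentiableAt.comp y hf
  rw [mvfderiv_eq_fderiv_chart (mem_extChartAt_source y) hf,
    mvfderiv_eq_fderiv_chart (mem_extChartAt_source y) hMf]
  have h := M.hasFDerivAt.comp (extChartAt 𝓘(ℝ, E) y y)
    (differentiableAt_comp_extChartAt_symm (mem_extChartAt_source y) hf).hasFDerivAt
  exact congrArg (fun L => L (chartDeriv y y v)) h.fderiv

end ChartDifferentiable

/-! ### The connection form in local coordinates -/

namespace FlatVB

open Set Topology VectorField

variable {d : ℕ} {X : Type u} [TopologicalSpace X]
    [ChartedSpace (EuclideanSpace ℝ (Fin d)) X] [IsManifold (𝓡 d) ∞ X]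
    {E : FlatVB.{u, v} d X} (t : SmoothVB.LocalTriv E.bundle)

/-- The smoothness of `∇_Y σ`. -/
theorem isSmoothSection_nabla {σ : ∀ y, E.bundle.fiber y} (hσ : E.bundle.IsSmoothSection σ)
    {Y : ∀ y : X, TangentSpace (𝓡 d) y} (hY : SmoothVB.IsSmoothVectorField Y) :
    E.bundle.IsSmoothSection (fun z => E.nabla σ z (Y z)) := by
  have h1 := E.smooth.contMDiff.contMDiff (σ := σ) (hσ.contMDiffOn)
  rw [contMDiffOn_univ] at h1
  exact ContMDiff.clm_bundle_apply h1 hY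

/-- The connection form of a trivialization. -/
noncomputable def connForm (y : X) :
    E.bundle.fiber y →L[ℝ] TangentSpace (𝓡 d) y →L[ℝ] E.bundle.fiber y :=
  (E.nabla.isCovariantDerivativeOn (s := t.U)).difference t.isCovariantDerivativeOn_flatCov y

theorem T_nabla {σ : ∀ y, E.bundle.fiber y} {y : X} (hy : y ∈ t.U)
    (hσ : MDifferentiableAt (𝓡 d) ((𝓡 d).prod 𝓘(ℝ, E.bundle.model))
      (fun z => (⟨z, σ z⟩ : E.bundle.Total)) y) (v : TangentSpace (𝓡 d) y) :
    t.T y (E.nabla σ y v) =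
      mvfderiv (𝓡 d) (fun z => t.T z (σ z)) y v + t.T y (connForm t y (σ y) v) := by
  have h := (E.nabla.isCovariantDerivativeOn (s := t.U)).difference_apply
    t.isCovariantDerivativeOn_flatCov hy hσ
  rw [connForm, h]
  simp [SmoothVB.LocalTriv.flatCov]

/-- The matrix-valued connection form at a point in the coordinates of the chart around `c`. -/
noncomputable def connCoordAt (c y : X) :
    EuclideanSpace ℝ (Fin d) →L[ℝ] (E.bundle.model →L[ℝ] E.bundle.model) :=
  LinearMap.toContinuousLinearMap <|
    (LinearMap.toContinuousLinearMap (𝕜 := ℝ) (E := E.bundle.model)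
      (F' := E.bundle.model)).toLinearMap ∘ₗ
    LinearMap.mk₂ ℝ (fun w u => t.T y (connForm t y ((t.T y).symm u) (coordField c w y)))
      (fun w w' u => by rw [coordField_add, map_add, map_add])
      (fun a w u => by rw [coordField_smul, map_smul, map_smul])
      (fun w u u' => by rw [map_add, map_add, add_apply, map_add])
      (fun a w u => by rw [map_smul, map_smul, smul_apply, map_smul])

/-- The matrix-valued connection form in the coordinates of the chart around `c`. -/
noncomputable def connCoord (c : X) (p : EuclideanSpace ℝ (Fin d)) :
    EuclideanSpace ℝ (Fin d) →L[ℝ] (E.bundle.model →L[ℝ] E.bundle.model) :=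
  connCoordAt t c ((extChartAt (𝓡 d) c).symm p)

theorem connCoord_apply {c y : X} (hy : y ∈ (extChartAt (𝓡 d) c).source)
    (w : EuclideanSpace ℝ (Fin d)) (u : E.bundle.model) :
    connCoord t c (extChartAt (𝓡 d) c y) w u =
      t.T y (connForm t y ((t.T y).symm u) (coordField c w y)) := by
  rw [connCoord, (extChartAt (𝓡 d) c).left_inv hy]
  rfl

/-- The connection in local coordinates. -/
theorem T_nabla_coord {σ : ∀ y, E.bundle.fiber y} {c y : X} (hy : y ∈ t.U)
    (hyc : y ∈ (extChartAt (𝓡 d) c).source)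
    (hσ : MDifferentiableAt (𝓡 d) ((𝓡 d).prod 𝓘(ℝ, E.bundle.model))
      (fun z => (⟨z, σ z⟩ : E.bundle.Total)) y) (v : TangentSpace (𝓡 d) y) :
    t.T y (E.nabla σ y v) =
      mvfderiv (𝓡 d) (fun z => t.T z (σ z)) y v +
        connCoord t c (extChartAt (𝓡 d) c y) (chartDeriv c y v) (t.T y (σ y)) := by
  rw [T_nabla t hy hσ, connCoord_apply t hyc, coordField_chartDeriv hyc,
    ContinuousLinearEquiv.symm_apply_apply]

/-- For a section with constant coordinates the derivative term vanishes, so its covariant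
derivatives along coordinate fields read off the entries of the connection form. -/
theorem eventually_T_nabla {σ : ∀ y, E.bundle.fiber y} (hσ : E.bundle.IsSmoothSection σ)
    {Y : ∀ y : X, TangentSpace (𝓡 d) y} {c y : X} (hy : y ∈ t.U)
    (hyc : y ∈ (extChartAt (𝓡 d) c).source) {u : E.bundle.model}
    {w : EuclideanSpace ℝ (Fin d)} (hu : ∀ᶠ z in 𝓝 y, t.T z (σ z) = u)
    (hw : ∀ᶠ z in 𝓝 y, Y z = coordField c w z) :
    ∀ᶠ z in 𝓝 y, t.T z (E.nabla σ z (Y z)) = connCoord t c (extChartAt (𝓡 d) c z) w u := by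
  filter_upwards [hu.eventually_nhds, hw, t.isOpen_U.mem_nhds hy,
    (isOpen_extChartAt_source c).mem_nhds hyc] with z hz1 hz2 hz3 hz4
  rw [T_nabla_coord t hz3 hz4 ((hσ z).mdifferentiableAt (by simp)), hz1.self_of_nhds, hz2,
    chartDeriv_coordField hz4, mvfderiv_congr hz1]
  simp [mvfderiv_const]

/-- The open set of coordinates on which the connection form is defined. -/
def coordDomain (c : X) : Set (EuclideanSpace ℝ (Fin d)) :=
  (extChartAt (𝓡 d) c).target ∩ (extChartAt (𝓡 d) c).symm ⁻¹' t.U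

theorem isOpen_coordDomain (c : X) : IsOpen (coordDomain t c) :=
  (continuousOn_extChartAt_symm c).isOpen_inter_preimage (isOpen_extChartAt_target c) t.isOpen_U

variable [T2Space X]

/-- Each entry is locally the coordinate expression of `∇_Y σ`, with `Y` a coordinate field and `σ`
a constant-coordinate section, both cut off to global smooth objects. Smoothness of the connection
makes it smooth. -/
theorem contDiffOn_connCoord (c : X) : ContDiffOn ℝ ∞ (connCoord t c) (coordDomain t c) := by
  rw [contDiffOn_clm_apply]
  intro w
  rw [contDiffOn_clm_apply]
  rintro u p ⟨hp, hpU⟩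
  refine ContDiffAt.contDiffWithinAt ?_
  set y := (extChartAt (𝓡 d) c).symm p with hyp
  have hyc : y ∈ (extChartAt (𝓡 d) c).source := (extChartAt (𝓡 d) c).map_target hp
  have hpy : extChartAt (𝓡 d) c y = p := (extChartAt (𝓡 d) c).right_inv hp
  obtain ⟨σ, hσ, hu⟩ := t.exists_smooth_section t.isOpen_U hpU subset_rfl
    (f := fun _ => u) contMDiffOn_const
  obtain ⟨Y, hY, hw⟩ := exists_smooth_vectorField c (isOpen_extChartAt_source c) hyc subset_rfl w
  have h1 := (t.contMDiffAt_section_iff hpU le_rfl).1 (isSmoothSection_nabla hσ hY y)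
  rw [contMDiffAt_iff_chart hyc le_rfl, hpy] at h1
  refine h1.congr_of_eventuallyEq ?_
  have h2 := (continuousAt_extChartAt_symm'' hp).eventually
    (eventually_T_nabla t hσ hpU hyc hu hw)
  filter_upwards [h2, (isOpen_extChartAt_target c).mem_nhds hp] with q hq hq2
  rw [hq, (extChartAt (𝓡 d) c).right_inv hq2]

/-- The left-hand side is the curvature evaluated on two coordinate fields and a constant-coordinate
section; the bracket term drops out because coordinate fields commute. The fields and the section
are extended globally since `IsFlat` tests only global ones. -/
theorem connCoord_flat (c : X) {p : EuclideanSpace ℝ (Fin d)} (hp : p ∈ coordDomain t c)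
    (v w : EuclideanSpace ℝ (Fin d)) :
    fderiv ℝ (connCoord t c) p v w - fderiv ℝ (connCoord t c) p w v
      + connCoord t c p v * connCoord t c p w - connCoord t c p w * connCoord t c p v = 0 := by
  have hdiff : DifferentiableAt ℝ (connCoord t c) p :=
    ((contDiffOn_connCoord t c).contDiffAt ((isOpen_coordDomain t c).mem_nhds hp)).differentiableAt
      (by simp)
  obtain ⟨hp, hpU⟩ := hp
  set y := (extChartAt (𝓡 d) c).symm p with hyp
  have hyc : y ∈ (extChartAt (𝓡 d) c).source := (extChartAt (𝓡 d) c).map_target hp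
  have hpy : extChartAt (𝓡 d) c y = p := (extChartAt (𝓡 d) c).right_inv hp
  ext1 u
  obtain ⟨σ, hσ, hu⟩ := t.exists_smooth_section t.isOpen_U hpU subset_rfl
    (f := fun _ => u) contMDiffOn_const
  have key : ∀ v w : EuclideanSpace ℝ (Fin d), ∀ V W : ∀ y : X, TangentSpace (𝓡 d) y,
      SmoothVB.IsSmoothVectorField W → (∀ᶠ z in 𝓝 y, V z = coordField c v z) →
      (∀ᶠ z in 𝓝 y, W z = coordField c w z) →
      t.T y (E.nabla (fun z => E.nabla σ z (W z)) y (V y)) =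
        fderiv ℝ (connCoord t c) p v w u + connCoord t c p v (connCoord t c p w u) := by
    intro v w V W hW hv hw
    have h1 := eventually_T_nabla t hσ hpU hyc hu hw
    rw [T_nabla_coord t hpU hyc ((isSmoothSection_nabla hσ hW y).mdifferentiableAt (by simp)),
      mvfderiv_congr h1, hv.self_of_nhds, chartDeriv_coordField hyc, h1.self_of_nhds, hpy,
      mvfderiv_comp_extChartAt (f := fun q => connCoord t c q w u) hyc, chartDeriv_coordField hyc,
      hpy]
    · have h2 : HasFDerivAt (fun q => connCoord t c q w u) _ p :=
        ((hdiff.hasFDerivAt.clm_apply (hasFDerivAt_const w p)).clm_apply (hasFDerivAt_const u p))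
      rw [h2.fderiv]
      simp
    · rw [hpy]
      fun_prop
  obtain ⟨V, hV, hv⟩ := exists_smooth_vectorField c (isOpen_extChartAt_source c) hyc subset_rfl v
  obtain ⟨W, hW, hw⟩ := exists_smooth_vectorField c (isOpen_extChartAt_source c) hyc subset_rfl w
  have hbr : mlieBracket (𝓡 d) V W y = 0 := by
    rw [Filter.EventuallyEq.mlieBracket_vectorField_eq hv hw]
    exact mlieBracket_coordField hyc v w
  have hflat := E.flat V W hV hW σ hσ y
  rw [hbr, map_zero, sub_zero] at hflat
  have h := congrArg (t.T y) hflat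
  rw [map_sub, key v w V W hW hv hw, key w v W V hV hw hv, map_zero] at h
  refine Eq.trans ?_ h
  simp only [sub_apply, add_apply,
    mul_apply_eq_comp]
  abel

end FlatVB

/-! ### Flat trivializations -/

section FlatTriv

open Set Topology

variable {d : ℕ} {X : Type u} [TopologicalSpace X]
    [ChartedSpace (EuclideanSpace ℝ (Fin d)) X] [IsManifold (𝓡 d) ∞ X]

open Classical in
/-- The trivialization obtained from `t` by a smooth change of frame over an open set. -/
noncomputable def SmoothVB.LocalTriv.changeFrame {E : SmoothVB.{u, v} d X} (t : E.LocalTriv)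
    {O : Set X} (hO : IsOpen O) (hOU : O ⊆ t.U) {g : X → E.model →L[ℝ] E.model}
    (hg : ContMDiffOn (𝓡 d) 𝓘(ℝ, E.model →L[ℝ] E.model) ∞ g O) (hu : ∀ y ∈ O, IsUnit (g y)) :
    E.LocalTriv where
  U := O
  isOpen_U := hO
  T y := if h : IsUnit (g y) then
    (t.T y).trans (ContinuousLinearEquiv.unitsEquiv ℝ E.model h.unit).symm else t.T y
  contMDiffOn_T := by
    have h1 : ContMDiffOn ((𝓡 d).prod 𝓘(ℝ, E.model)) 𝓘(ℝ, E.model →L[ℝ] E.model) ∞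
        (fun p : E.Total => Ring.inverse (g p.1)) (π E.model E.fiber ⁻¹' O) := by
      intro p hp
      obtain ⟨w, hw⟩ := hu p.1 hp
      have h2 : ContMDiffAt 𝓘(ℝ, E.model →L[ℝ] E.model) 𝓘(ℝ, E.model →L[ℝ] E.model) ∞
          Ring.inverse (g p.1) := by
        rw [← hw]
        exact (contDiffAt_ringInverse ℝ w).contMDiffAt
      exact (h2.comp p ((hg.contMDiffAt (hO.mem_nhds hp)).comp p
        (contMDiff_proj E.fiber).contMDiffAt)).contMDiffWithinAt
    refine (h1.clm_apply (t.contMDiffOn_T.mono (preimage_mono hOU))).congr fun p hp => ?_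
    have h := hu p.1 hp
    simp only [h, dif_pos]
    rw [Ring.inverse_of_isUnit h]
    rfl
  contMDiffOn_symm := by
    have h1 : ContMDiffOn ((𝓡 d).prod 𝓘(ℝ, E.model)) ((𝓡 d).prod 𝓘(ℝ, E.model)) ∞
        (fun p : X × E.model => (p.1, g p.1 p.2)) (O ×ˢ univ) :=
      contMDiffOn_fst.prodMk ((hg.comp contMDiffOn_fst fun p hp => hp.1).clm_apply contMDiffOn_snd)
    refine (t.contMDiffOn_symm.comp h1 fun p hp => ⟨hOU hp.1, mem_univ _⟩).congr fun p hp => ?_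
    have h := hu p.1 hp.1
    simp only [h, dif_pos, Function.comp]
    rfl

theorem SmoothVB.LocalTriv.changeFrame_T {E : SmoothVB.{u, v} d X} (t : E.LocalTriv)
    {O : Set X} (hO : IsOpen O) (hOU : O ⊆ t.U) {g : X → E.model →L[ℝ] E.model}
    (hg : ContMDiffOn (𝓡 d) 𝓘(ℝ, E.model →L[ℝ] E.model) ∞ g O) (hu : ∀ y ∈ O, IsUnit (g y))
    {y : X} (hy : y ∈ O) (a : E.fiber y) :
    g y ((t.changeFrame hO hOU hg hu).T y a) = t.T y a := by
  have h := hu y hy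
  simp only [changeFrame, h, dif_pos]
  exact (ContinuousLinearEquiv.unitsEquiv ℝ E.model h.unit).apply_symm_apply _

namespace FlatVB

/-- A trivialization is flat if it identifies the connection with the exterior derivative. -/
def IsFlatTriv (E : FlatVB.{u, v} d X) (t : E.bundle.LocalTriv) : Prop :=
  ∀ (σ : ∀ y, E.bundle.fiber y) (y : X), y ∈ t.U →
    MDifferentiableAt (𝓡 d) ((𝓡 d).prod 𝓘(ℝ, E.bundle.model))
      (fun z => (⟨z, σ z⟩ : E.bundle.Total)) y →
    ∀ v, t.T y (E.nabla σ y v) = mvfderiv (𝓡 d) (fun z => t.T z (σ z)) y v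

/-- Flat vector bundles are locally trivial as bundles with connection. -/
theorem exists_isFlatTriv [T2Space X] (E : FlatVB.{u, v} d X) (c : X) :
    ∃ t : E.bundle.LocalTriv, c ∈ t.U ∧ E.IsFlatTriv t := by
  set t := E.bundle.localTrivAt c with ht
  set ψ := extChartAt (𝓡 d) c with hψ
  have hc : ψ c ∈ coordDomain t c := by
    refine ⟨mem_extChartAt_target c, ?_⟩
    rw [mem_preimage, extChartAt_to_inv]
    exact E.bundle.mem_localTrivAt c
  obtain ⟨r, hr, hball, G, hG, hGu, hGd⟩ := exists_gauge (isOpen_coordDomain t c) hc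
    (contDiffOn_connCoord t c) fun p hp v w => connCoord_flat t c hp v w
  set O : Set X := ψ.source ∩ ψ ⁻¹' Metric.ball (ψ c) r with hOdef
  have hO : IsOpen O :=
    (continuousOn_extChartAt c).isOpen_inter_preimage (isOpen_extChartAt_source c)
      Metric.isOpen_ball
  have hOU : O ⊆ t.U := by
    rintro y ⟨hy1, hy2⟩
    have := (hball hy2).2
    rwa [mem_preimage, ψ.left_inv hy1] at this
  have hg : ContMDiffOn (𝓡 d) 𝓘(ℝ, E.bundle.model →L[ℝ] E.bundle.model) ∞ (fun y => G (ψ y)) O := by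
    intro y hy
    refine ContMDiffAt.contMDiffWithinAt ?_
    have h1 : ContDiffAt ℝ ∞ G (ψ y) := hG.contDiffAt (Metric.isOpen_ball.mem_nhds hy.2)
    exact h1.contMDiffAt.comp y (contMDiffAt_extChartAt_of_mem hy.1 le_rfl)
  have hu : ∀ y ∈ O, IsUnit (G (ψ y)) := fun y hy => hGu _ hy.2
  refine ⟨t.changeFrame hO hOU hg hu, ⟨mem_extChartAt_source c, Metric.mem_ball_self hr⟩, ?_⟩
  set t' := t.changeFrame hO hOU hg hu with ht'
  intro σ y hy hσ v
  have hT : ∀ z ∈ O, ∀ a, G (ψ z) (t'.T z a) = t.T z a := fun z hz a =>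
    t.changeFrame_T hO hOU hg hu hz a
  have hinj : Function.Injective (G (ψ y)) := by
    obtain ⟨w, hw⟩ := hu y hy
    rw [← hw]
    exact (ContinuousLinearEquiv.unitsEquiv ℝ _ w).injective
  apply hinj
  rw [hT y hy, T_nabla_coord t (hOU hy) hy.1 hσ, ← hT y hy (σ y)]
  have hh : MDifferentiableAt (𝓡 d) 𝓘(ℝ, E.bundle.model) (fun z => t'.T z (σ z)) y :=
    (t'.mdifferentiableAt_section_iff hy).1 hσ
  have hf : MDifferentiableAt (𝓡 d) 𝓘(ℝ, E.bundle.model) (fun z => t.T z (σ z)) y :=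
    (t.mdifferentiableAt_section_iff (hOU hy)).1 hσ
  rw [mvfderiv_eq_fderiv_chart hy.1 hh, mvfderiv_eq_fderiv_chart hy.1 hf]
  have hGy : HasFDerivAt G (fderiv ℝ G (ψ y)) (ψ y) :=
    ((hG.contDiffAt (Metric.isOpen_ball.mem_nhds hy.2)).differentiableAt (by simp)).hasFDerivAt
  have hprod := hGy.clm_apply (differentiableAt_comp_extChartAt_symm hy.1 hh).hasFDerivAt
  have heq : (fun p => t.T (ψ.symm p) (σ (ψ.symm p))) =ᶠ[𝓝 (ψ y)]
      fun p => G p (t'.T (ψ.symm p) (σ (ψ.symm p))) := by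
    filter_upwards [Metric.isOpen_ball.mem_nhds hy.2] with p hp
    have hpt := (hball hp).1
    have hpO : ψ.symm p ∈ O := by
      refine ⟨ψ.map_target hpt, ?_⟩
      rwa [mem_preimage, ψ.right_inv hpt]
    rw [← hT _ hpO, ψ.right_inv hpt]
  rw [heq.fderiv_eq, hprod.fderiv]
  -- With `T = G T'`, the product rule gives `d (T σ) = dG (T' σ) + G d (T' σ)`, and `dG = -A G`
  -- cancels the connection term `A (T σ)`.
  have := hGd (ψ y) hy.2 (chartDeriv c y v)
  simp only [add_apply, ContinuousLinearMap.comp_apply, ContinuousLinearMap.flip_apply, this,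
    neg_apply, mul_apply_eq_comp]
  rw [ψ.left_inv hy.1]
  abel

end FlatVB

end FlatTriv

/-! ### Morphisms of local systems -/

namespace LocalSystem

open Set Topology

variable {X : Type*} [TopologicalSpace X]
  {F : Type*} [AddCommGroup F] [Module ℝ F]
  {V : X → Type*} [∀ y, AddCommGroup (V y)] [∀ y, Module ℝ (V y)] (S : LocalSystem X F V)
  {F' : Type*} [AddCommGroup F'] [Module ℝ F']
  {V' : X → Type*} [∀ y, AddCommGroup (V' y)] [∀ y, Module ℝ (V' y)] (S' : LocalSystem X F' V')

/-- A family of linear maps between the fibres of two local systems is a morphism of local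
systems if it is locally constant in the trivializations. -/
def IsMorphism (φ : ∀ y, V y →ₗ[ℝ] V' y) : Prop :=
  ∀ c c' y, y ∈ S.U c → y ∈ S'.U c' → ∀ᶠ z in 𝓝 y, ∀ u : F,
    S'.T c' z (φ z ((S.T c z).symm u)) = S'.T c' y (φ y ((S.T c y).symm u))

variable {S S'}

/-- A map on a path which is locally constant takes the same value at both ends. -/
theorem _root_.Path.eq_of_eventually_eq {α : Type*} {y z : X} (γ : Path y z) {f : X → α}
    (hf : ∀ w ∈ range γ, ∀ᶠ w' in 𝓝 w, f w' = f w) : f y = f z := by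
  have h : IsLocallyConstant (fun t => f (γ t)) := by
    rw [IsLocallyConstant.iff_eventually_eq]
    exact fun t => γ.continuous.continuousAt.eventually (hf (γ t) ⟨t, rfl⟩)
  have := h.apply_eq_of_preconnectedSpace 0 1
  simpa using this

/-- Along a short path the matrix of `φ` is locally constant, hence equal at both ends, while both
transports are the identity in coordinates. Concatenation extends this to all paths. -/
theorem IsMorphism.transport {φ : ∀ y, V y →ₗ[ℝ] V' y} (hφ : S.IsMorphism S' φ) {y z : X}
    (γ : Path.Homotopic.Quotient y z) (a : V y) :
    φ z (S.transport γ a) = S'.transport γ (φ y a) := by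
  revert a
  refine Path.Homotopic.Quotient.induction_of_cover (U := fun c => S.U c ∩ S'.U c)
    (fun c => (S.isOpen_U c).inter (S'.isOpen_U c)) (fun c => ⟨S.mem_U c, S'.mem_U c⟩)
    (P := fun {y z} γ => ∀ a : V y, φ z (S.transport γ a) = S'.transport γ (φ y a)) ?_ ?_ γ
  · intro a b c p q hp hq v
    rw [S.transport_trans, hq, hp, S'.transport_trans]
  · intro c y z γ hγ a
    rw [S.transport_mk_of_subset γ (hγ.trans inter_subset_left),
      S'.transport_mk_of_subset γ (hγ.trans inter_subset_right)]
    have h := γ.eq_of_eventually_eq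
      (f := fun z => fun u : F => S'.T c z (φ z ((S.T c z).symm u))) fun w hw =>
        (hφ c c w (hγ hw).1 (hγ hw).2).mono fun z hz => funext hz
    have h2 := congrFun h (S.T c y a)
    simp only [LinearEquiv.symm_apply_apply] at h2
    rw [h2, LinearEquiv.symm_apply_apply]

/-- Nearby points are joined by paths inside both trivializing domains, where transport preserves
coordinates; commuting with it forces the matrix of `φ` to be constant. -/
theorem isMorphism_of_transport [LocallyPathConnectedSpace X] {φ : ∀ y, V y →ₗ[ℝ] V' y}
    (hφ : ∀ {y z : X} (γ : Path.Homotopic.Quotient y z) (a : V y),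
      φ z (S.transport γ a) = S'.transport γ (φ y a)) : S.IsMorphism S' φ := by
  intro c c' y hy hy'
  obtain ⟨N, ⟨hN, hNp⟩, hNs⟩ := (path_connected_basis y).mem_iff.1
    (((S.isOpen_U c).inter (S'.isOpen_U c')).mem_nhds ⟨hy, hy'⟩)
  filter_upwards [hN] with z hz u
  obtain ⟨γ, hγ⟩ := hNp.joinedIn y (mem_of_mem_nhds hN) z hz
  have hr : range γ ⊆ S.U c ∩ S'.U c' := by
    rintro _ ⟨t, rfl⟩
    exact hNs (hγ t)
  have h := hφ (.mk γ) ((S.T c y).symm u)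
  rw [S.transport_mk_of_subset γ (hr.trans inter_subset_left),
      S'.transport_mk_of_subset γ (hr.trans inter_subset_right),
      LinearEquiv.apply_symm_apply] at h
  rw [h, LinearEquiv.apply_symm_apply]

theorem transport_trans_symm {y z : X} (γ : Path.Homotopic.Quotient y z) (a : V y) :
    S.transport γ.symm (S.transport γ a) = a := by
  rw [← S.transport_trans, Path.Homotopic.Quotient.trans_symm, S.transport_refl]

theorem transport_symm_trans {y z : X} (γ : Path.Homotopic.Quotient y z) (a : V z) :
    S.transport γ (S.transport γ.symm a) = a := by
  rw [← S.transport_trans, Path.Homotopic.Quotient.symm_trans, S.transport_refl]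

theorem transport_symm_eq_iff {y z : X} {γ : Path.Homotopic.Quotient y z} {a : V y} {b : V z} :
    S.transport γ.symm b = a ↔ b = S.transport γ a := by
  constructor
  · rintro rfl
    rw [transport_symm_trans]
  · rintro rfl
    rw [transport_trans_symm]

/-- A linear map between the fibres over `x` which commutes with the monodromy extends to a
morphism of local systems. -/
theorem exists_isMorphism [LocallyPathConnectedSpace X] [PathConnectedSpace X] {x : X}
    (f : V x →ₗ[ℝ] V' x)
    (hf : ∀ (γ : Path.Homotopic.Quotient x x) a, f (S.transport γ a) = S'.transport γ (f a)) :
    ∃ φ : ∀ y, V y →ₗ[ℝ] V' y, S.IsMorphism S' φ ∧ φ x = f := by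
  let p : ∀ y, Path.Homotopic.Quotient x y := fun y => .mk (PathConnectedSpace.somePath x y)
  -- Conjugating `f` by transport does not depend on the path, because two paths differ by the loop
  -- `q.trans q'.symm`, with which `f` commutes.
  have key : ∀ {y : X} (q q' : Path.Homotopic.Quotient x y) (a : V y),
      S'.transport q (f (S.transport q.symm a)) = S'.transport q' (f (S.transport q'.symm a)) := by
    intro y q q' a
    have h := hf (q.trans q'.symm) (S.transport q.symm a)
    rw [S.transport_trans, transport_symm_trans, S'.transport_trans] at h
    rw [h, transport_symm_trans]
  refine ⟨fun y => S'.transport (p y) ∘ₗ f ∘ₗ S.transport (p y).symm, ?_, ?_⟩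
  · refine isMorphism_of_transport fun {y z} γ a => ?_
    have h := key (p z) ((p y).trans γ) (S.transport γ a)
    simp only [LinearMap.comp_apply]
    rw [h, S'.transport_trans]
    congr 3
    rw [transport_symm_eq_iff, S.transport_trans, transport_symm_trans]
  · ext a
    simp only [LinearMap.comp_apply]
    rw [key (p x) (.refl x)]
    rw [S'.transport_refl, transport_symm_eq_iff.2 (S.transport_refl x a).symm]

end LocalSystem

/-! ### The local system of a flat vector bundle -/

section LocallyConstant

open Set Topology

/-- In a chart this is the vanishing-derivative criterion on a ball, which is connected. -/
theorem eventually_eq_of_mvfderiv_eq_zero {E : Type*} [NormedAddCommGroup E] [NormedSpace ℝ E]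
    {X : Type*} [TopologicalSpace X] [ChartedSpace E X] [IsManifold 𝓘(ℝ, E) ∞ X] {y : X}
    {H : Type*} [NormedAddCommGroup H] [NormedSpace ℝ H] {f : X → H}
    (hf : ∀ᶠ z in 𝓝 y, MDifferentiableAt 𝓘(ℝ, E) 𝓘(ℝ, H) f z ∧
      ∀ v, mvfderiv 𝓘(ℝ, E) f z v = 0) : ∀ᶠ z in 𝓝 y, f z = f y := by
  set ψ := extChartAt 𝓘(ℝ, E) y with hψ
  have hy : y ∈ ψ.source := mem_extChartAt_source y
  have h1 : ∀ᶠ p in 𝓝 (ψ y), p ∈ ψ.target ∧ MDifferentiableAt 𝓘(ℝ, E) 𝓘(ℝ, H) f (ψ.symm p) ∧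
      ∀ v, mvfderiv 𝓘(ℝ, E) f (ψ.symm p) v = 0 := by
    have h2 : Filter.Tendsto ψ.symm (𝓝 (ψ y)) (𝓝 y) := by
      have h := continuousAt_extChartAt_symm (I := 𝓘(ℝ, E)) y
      rwa [ContinuousAt, extChartAt_to_inv] at h
    exact Filter.Eventually.and ((isOpen_extChartAt_target y).mem_nhds (ψ.map_source hy))
      (h2.eventually hf)
  obtain ⟨r, hr, hball⟩ := Metric.eventually_nhds_iff_ball.1 h1
  have hd : ∀ p ∈ Metric.ball (ψ y) r, HasFDerivAt (fun p => f (ψ.symm p)) (0 : E →L[ℝ] H) p := by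
    intro p hp
    obtain ⟨hpt, hpd, hp0⟩ := hball p hp
    have hs := ψ.map_target hpt
    have h3 := differentiableAt_comp_extChartAt_symm hs hpd
    have h4 := mvfderiv_eq_fderiv_chart hs hpd
    rw [ψ.right_inv hpt] at h3 h4
    have h5 : fderiv ℝ (fun p => f (ψ.symm p)) p = 0 := by
      ext w
      have h6 := h4 (coordField y w _)
      rw [chartDeriv_coordField hs, hp0] at h6
      exact h6.symm
    rw [← h5]
    exact h3.hasFDerivAt
  have h7 : ∀ᶠ z in 𝓝 y, z ∈ ψ.source ∧ ψ z ∈ Metric.ball (ψ y) r :=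
    Filter.Eventually.and ((isOpen_extChartAt_source y).mem_nhds hy)
      ((continuousAt_extChartAt y).eventually (Metric.ball_mem_nhds _ hr))
  filter_upwards [h7] with z hz
  have h8 := Metric.isOpen_ball.is_const_of_fderiv_eq_zero (𝕜 := ℝ)
    (convex_ball (ψ y) r).isPreconnected
    (fun p hp => (hd p hp).differentiableAt.differentiableWithinAt) (fun p hp => (hd p hp).fderiv)
    hz.2 (Metric.mem_ball_self hr)
  simpa only [ψ.left_inv hz.1, ψ.left_inv hy] using h8

end LocallyConstant

/-! ### Parallel frames as a local system, and morphisms of flat bundles -/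

namespace FlatVB

open Set Topology

variable {d : ℕ} {X : Type u} [TopologicalSpace X]
    [ChartedSpace (EuclideanSpace ℝ (Fin d)) X] [IsManifold (𝓡 d) ∞ X] [T2Space X]
    {E E' : FlatVB.{u, v} d X}

/-- Morphisms of flat bundles are locally constant in flat trivializations. -/
theorem eventually_hom_eq (φ : E ⟶ E') {t : E.bundle.LocalTriv} (ht : E.IsFlatTriv t)
    {t' : E'.bundle.LocalTriv} (ht' : E'.IsFlatTriv t') {y : X} (hy : y ∈ t.U) (hy' : y ∈ t'.U) :
    ∀ᶠ z in 𝓝 y, ∀ u, t'.T z (φ.hom.app z ((t.T z).symm u)) =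
      t'.T y (φ.hom.app y ((t.T y).symm u)) := by
  have key : ∀ u, ∀ᶠ z in 𝓝 y, t'.T z (φ.hom.app z ((t.T z).symm u)) =
      t'.T y (φ.hom.app y ((t.T y).symm u)) := by
    intro u
    obtain ⟨σ, hσ, hu⟩ := t.exists_smooth_section t.isOpen_U hy subset_rfl
      (f := fun _ => u) contMDiffOn_const
    have hu' : ∀ᶠ z in 𝓝 y, σ z = (t.T z).symm u := by
      filter_upwards [hu] with z hz
      rw [← hz, ContinuousLinearEquiv.symm_apply_apply]
    have h1 : ∀ᶠ z in 𝓝 y, t'.T z (φ.hom.app z (σ z)) = t'.T y (φ.hom.app y (σ y)) := by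
      -- The section `σ` is parallel near `y`, so its image under `φ` is parallel too and has
      -- vanishing derivative in the flat frame `t'`.
      refine eventually_eq_of_mvfderiv_eq_zero (E := EuclideanSpace ℝ (Fin d)) ?_
      filter_upwards [t.isOpen_U.mem_nhds hy, t'.isOpen_U.mem_nhds hy', hu.eventually_nhds]
        with z hz hz' hzu
      have hφσ : MDifferentiableAt (𝓡 d) ((𝓡 d).prod 𝓘(ℝ, E'.bundle.model))
          (fun z => (⟨z, φ.hom.app z (σ z)⟩ : E'.bundle.Total)) z :=
        ((φ.hom.smooth.comp hσ) z).mdifferentiableAt (by simp)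
      refine ⟨(t'.mdifferentiableAt_section_iff hz').1 hφσ, fun v => ?_⟩
      rw [← ht' (fun z => φ.hom.app z (σ z)) z hz' hφσ, φ.compatible σ hσ]
      have h2 := ht σ z hz ((hσ z).mdifferentiableAt (by simp)) v
      rw [mvfderiv_congr hzu, mvfderiv_const] at h2
      have h3 : E.nabla σ z v = 0 := (t.T z).injective (h2.trans (map_zero (t.T z)).symm)
      rw [ContinuousLinearMap.comp_apply, h3, map_zero, map_zero]
    filter_upwards [h1, hu'] with z hz1 hz2
    rw [← hz2, hz1, hu'.self_of_nhds]
  -- The neighbourhood found so far depends on `u`; finitely many basis vectors give one that serves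
  -- all `u`.
  let b := Module.finBasis ℝ E.bundle.model
  filter_upwards [Filter.eventually_all.2 fun i => key (b i)] with z hz
  let L : X → (E.bundle.model →ₗ[ℝ] E'.bundle.model) := fun z =>
    (t'.T z).toLinearMap ∘ₗ (φ.hom.app z).toLinearMap ∘ₗ (t.T z).symm.toLinearMap
  have h : L z = L y := b.ext hz
  exact fun u => LinearMap.congr_fun h u

variable (E) in
/-- A chosen flat trivialization around a point. -/
noncomputable def flatTriv (c : X) : E.bundle.LocalTriv := (E.exists_isFlatTriv c).choose

variable (E) in
theorem mem_flatTriv (c : X) : c ∈ (E.flatTriv c).U := (E.exists_isFlatTriv c).choose_spec.1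

variable (E) in
theorem isFlatTriv_flatTriv (c : X) : E.IsFlatTriv (E.flatTriv c) :=
  (E.exists_isFlatTriv c).choose_spec.2

variable (E) in
/-- The local system of parallel sections of a flat vector bundle. -/
noncomputable def localSystem : LocalSystem X E.bundle.model E.bundle.fiber where
  U c := (E.flatTriv c).U
  isOpen_U c := (E.flatTriv c).isOpen_U
  mem_U := E.mem_flatTriv
  T c y := ((E.flatTriv c).T y).toLinearEquiv
  locConst c c' _ hy hy' :=
    eventually_hom_eq (𝟙 E) (E.isFlatTriv_flatTriv c) (E.isFlatTriv_flatTriv c') hy hy'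

theorem isMorphism_hom (φ : E ⟶ E') :
    E.localSystem.IsMorphism E'.localSystem fun y => (φ.hom.app y).toLinearMap :=
  fun c c' _ hy hy' =>
    eventually_hom_eq φ (E.isFlatTriv_flatTriv c) (E'.isFlatTriv_flatTriv c') hy hy'

/-- Linear maps between fibres of vector bundles are continuous. -/
noncomputable def fiberMap {y : X} (f : E.bundle.fiber y →ₗ[ℝ] E'.bundle.fiber y) :
    E.bundle.fiber y →L[ℝ] E'.bundle.fiber y :=
  ((E'.bundle.fiberEquiv y).symm : _ →L[ℝ] _) ∘L
    LinearMap.toContinuousLinearMap ((E'.bundle.fiberEquiv y).toLinearMap ∘ₗ f ∘ₗ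
      (E.bundle.fiberEquiv y).symm.toLinearMap) ∘L (E.bundle.fiberEquiv y : _ →L[ℝ] _)

omit [T2Space X] in
theorem fiberMap_apply {y : X} (f : E.bundle.fiber y →ₗ[ℝ] E'.bundle.fiber y)
    (a : E.bundle.fiber y) : fiberMap f a = f a := by
  simp [fiberMap]

/-- The matrix at a point of a family of linear maps in the flat trivializations. -/
noncomputable def flatMatrix (φ : ∀ y, E.bundle.fiber y →ₗ[ℝ] E'.bundle.fiber y) (y : X) :
    E.bundle.model →L[ℝ] E'.bundle.model :=
  LinearMap.toContinuousLinearMap (((E'.flatTriv y).T y).toLinearMap ∘ₗ φ y ∘ₗ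
    ((E.flatTriv y).T y).symm.toLinearMap)

theorem eventually_flatMatrix {φ : ∀ y, E.bundle.fiber y →ₗ[ℝ] E'.bundle.fiber y}
    (hφ : E.localSystem.IsMorphism E'.localSystem φ) (y : X) :
    ∀ᶠ z in 𝓝 y, ∀ a, (E'.flatTriv y).T z (φ z a) = flatMatrix φ y ((E.flatTriv y).T z a) := by
  filter_upwards [hφ y y y (E.mem_flatTriv y) (E'.mem_flatTriv y)] with z hz a
  have h1 : ((E.flatTriv y).T z).symm ((E.flatTriv y).T z a) = a :=
    ContinuousLinearEquiv.symm_apply_apply _ _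
  have h := hz ((E.flatTriv y).T z a)
  refine Eq.trans ?_ h
  exact congrArg (fun a => (E'.flatTriv y).T z (φ z a)) h1.symm

/-- A morphism of the local systems of parallel sections defines a morphism of flat bundles. -/
noncomputable def homOfIsMorphism (φ : ∀ y, E.bundle.fiber y →ₗ[ℝ] E'.bundle.fiber y)
    (hφ : E.localSystem.IsMorphism E'.localSystem φ) : E ⟶ E' where
  hom :=
    { app := fun y => fiberMap (φ y)
      smooth := by
        intro p
        set y := p.1 with hy
        -- Near `y` the map is a constant matrix between flat frames, and is therefore as smooth as
        -- the frames.
        have h1 : ContMDiffAt ((𝓡 d).prod 𝓘(ℝ, E.bundle.model)) ((𝓡 d).prod 𝓘(ℝ, E'.bundle.model))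
            ∞ (fun q : E.bundle.Total => (q.1, flatMatrix φ y ((E.flatTriv y).T q.1 q.2))) p :=
          (contMDiff_proj E.bundle.fiber).contMDiffAt.prodMk
            ((flatMatrix φ y).contMDiff.contMDiffAt.comp p
              ((E.flatTriv y).contMDiffAt_T (E.mem_flatTriv y)))
        have h2 := ((E'.flatTriv y).contMDiffAt_symm (E'.mem_flatTriv y)
          (flatMatrix φ y ((E.flatTriv y).T p.1 p.2))).comp p h1
        refine h2.congr_of_eventuallyEq ?_
        have h3 := ((FiberBundle.continuous_proj E.bundle.model
          E.bundle.fiber).continuousAt (x := p)).eventually (eventually_flatMatrix hφ y)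
        filter_upwards [h3] with q hq
        simp only [Function.comp, fiberMap_apply]
        rw [← hq q.2, ContinuousLinearEquiv.symm_apply_apply] }
  compatible σ hσ y := by
    ext v
    simp only [fiberMap_apply, ContinuousLinearMap.comp_apply]
    apply ((E'.flatTriv y).T y).injective
    have hσd : MDifferentiableAt (𝓡 d) ((𝓡 d).prod 𝓘(ℝ, E.bundle.model))
        (fun z => (⟨z, σ z⟩ : E.bundle.Total)) y := (hσ y).mdifferentiableAt (by simp)
    have hf := ((E.flatTriv y).mdifferentiableAt_section_iff (E.mem_flatTriv y)).1 hσd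
    have hev : ∀ᶠ z in 𝓝 y, (E'.flatTriv y).T z (φ z (σ z)) =
        flatMatrix φ y ((E.flatTriv y).T z (σ z)) :=
      (eventually_flatMatrix hφ y).mono fun z hz => hz (σ z)
    have hMf : MDifferentiableAt (𝓡 d) 𝓘(ℝ, E'.bundle.model)
        (fun z => flatMatrix φ y ((E.flatTriv y).T z (σ z))) y :=
      (flatMatrix φ y).mdifferentiableAt.comp y hf
    have hφσ := ((E'.flatTriv y).mdifferentiableAt_section_iff (σ := fun z => φ z (σ z))
      (E'.mem_flatTriv y)).2 (hMf.congr_of_eventuallyEq hev)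
    rw [E'.isFlatTriv_flatTriv y _ y (E'.mem_flatTriv y) hφσ,
      (eventually_flatMatrix hφ y).self_of_nhds,
      E.isFlatTriv_flatTriv y σ y (E.mem_flatTriv y) hσd, mvfderiv_congr hev,
      mvfderiv_clm_comp _ hf]

theorem homOfIsMorphism_app (φ : ∀ y, E.bundle.fiber y →ₗ[ℝ] E'.bundle.fiber y)
    (hφ : E.localSystem.IsMorphism E'.localSystem φ) (y : X) (a : E.bundle.fiber y) :
    (homOfIsMorphism φ hφ).hom.app y a = φ y a :=
  fiberMap_apply _ _

end FlatVB

/-! ### The commutator of derivations -/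

section Commutator

open Set Topology VectorField

variable {E : Type*} [NormedAddCommGroup E] [NormedSpace ℝ E] [CompleteSpace E]
    {X : Type*} [TopologicalSpace X]
    [ChartedSpace E X] [IsManifold 𝓘(ℝ, E) ∞ X] {y : X}
    {H : Type*} [NormedAddCommGroup H] [NormedSpace ℝ H] {f : X → H}

/-- The components of a vector field in the chart around `c`. -/
noncomputable def fieldCoord (c : X) (Z : ∀ z : X, TangentSpace 𝓘(ℝ, E) z) : E → E :=
  mpullbackWithin 𝓘(ℝ, E) 𝓘(ℝ, E) (extChartAt 𝓘(ℝ, E) c).symm Z (range 𝓘(ℝ, E))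

omit [CompleteSpace E] in
theorem fieldCoord_extChartAt {c z : X} (hz : z ∈ (extChartAt 𝓘(ℝ, E) c).source)
    (Z : ∀ z : X, TangentSpace 𝓘(ℝ, E) z) :
    fieldCoord c Z (extChartAt 𝓘(ℝ, E) c z) = chartDeriv c z (Z z) := by
  have h1 := mfderivWithin_extChartAt_symm_comp_mfderiv_extChartAt' (I := 𝓘(ℝ, E)) hz
  have h2 := (isInvertible_mfderivWithin_extChartAt_symm (I := 𝓘(ℝ, E))
    ((extChartAt 𝓘(ℝ, E) c).map_source hz))
  have h5 : fieldCoord c Z (extChartAt 𝓘(ℝ, E) c z) =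
      (mfderivWithin 𝓘(ℝ, E) 𝓘(ℝ, E) (extChartAt 𝓘(ℝ, E) c).symm (range 𝓘(ℝ, E))
        (extChartAt 𝓘(ℝ, E) c z)).inverse (Z z) := by
    have h6 : ∀ z', z' = z → (Z z' : E) = Z z := by rintro _ rfl; rfl
    exact congrArg (mfderivWithin 𝓘(ℝ, E) 𝓘(ℝ, E) (extChartAt 𝓘(ℝ, E) c).symm (range 𝓘(ℝ, E))
        (extChartAt 𝓘(ℝ, E) c z)).inverse (h6 _ ((extChartAt 𝓘(ℝ, E) c).left_inv hz))
  have h4 := congrArg (fun L => L (Z z)) h1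
  exact h5.trans (h2.inverse_apply_eq.2 h4.symm)

theorem differentiableAt_fieldCoord {Z : ∀ z : X, TangentSpace 𝓘(ℝ, E) z}
    (hZ : MDifferentiableAt 𝓘(ℝ, E) 𝓘(ℝ, E).tangent
      (fun z => (⟨z, Z z⟩ : TangentBundle 𝓘(ℝ, E) X)) y) :
    DifferentiableAt ℝ (fieldCoord y Z) (extChartAt 𝓘(ℝ, E) y y) := by
  have : IsManifold 𝓘(ℝ, E) 2 X := .of_le (n := ∞) (by norm_cast)
  have h := MDifferentiableWithinAt.differentiableWithinAt_mpullbackWithin_vectorField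
    hZ.mdifferentiableWithinAt (s := univ)
  have hs : ((extChartAt 𝓘(ℝ, E) y).symm ⁻¹' univ ∩ range 𝓘(ℝ, E)) = univ := by simp
  rw [hs] at h
  exact differentiableWithinAt_univ.1 h

omit [CompleteSpace E] in
-- By definition the bracket on the manifold is the coordinate bracket pulled back along the chart
-- at `y`; applying the chart derivative undoes the pullback.
theorem chartDeriv_mlieBracket (Y Z : ∀ z : X, TangentSpace 𝓘(ℝ, E) z) :
    chartDeriv y y (mlieBracket 𝓘(ℝ, E) Y Z y) =
      lieBracket ℝ (fieldCoord y Y) (fieldCoord y Z) (extChartAt 𝓘(ℝ, E) y y) := by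
  have h : ∀ b : E, chartDeriv y y
      ((mfderiv 𝓘(ℝ, E) 𝓘(ℝ, E) (extChartAt 𝓘(ℝ, E) y) y).inverse b) = b := fun b =>
    (isInvertible_mfderiv_extChartAt (I := 𝓘(ℝ, E))
      (mem_extChartAt_source y)).self_apply_inverse b
  have hs : ((extChartAt 𝓘(ℝ, E) y).symm ⁻¹' univ ∩ range 𝓘(ℝ, E)) = univ := by simp
  rw [← lieBracketWithin_univ, ← hs]
  exact h _

/-- In a chart both iterated derivatives expand by the product rule; the second-derivative terms
cancel by symmetry and the rest is the coordinate bracket. This yields flatness of the glued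
connection. -/
theorem mvfderiv_mvfderiv_sub (hf : ContMDiffAt 𝓘(ℝ, E) 𝓘(ℝ, H) ∞ f y)
    {Y Z : ∀ z : X, TangentSpace 𝓘(ℝ, E) z}
    (hY : MDifferentiableAt 𝓘(ℝ, E) 𝓘(ℝ, E).tangent
      (fun z => (⟨z, Y z⟩ : TangentBundle 𝓘(ℝ, E) X)) y)
    (hZ : MDifferentiableAt 𝓘(ℝ, E) 𝓘(ℝ, E).tangent
      (fun z => (⟨z, Z z⟩ : TangentBundle 𝓘(ℝ, E) X)) y) :
    mvfderiv 𝓘(ℝ, E) (fun z => mvfderiv 𝓘(ℝ, E) f z (Z z)) y (Y y)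
      - mvfderiv 𝓘(ℝ, E) (fun z => mvfderiv 𝓘(ℝ, E) f z (Y z)) y (Z y)
      = mvfderiv 𝓘(ℝ, E) f y (mlieBracket 𝓘(ℝ, E) Y Z y) := by
  set ψ := extChartAt 𝓘(ℝ, E) y with hψ
  have hy : y ∈ ψ.source := mem_extChartAt_source y
  set g : E → H := fun p => f (ψ.symm p) with hg
  have hgs : ContDiffAt ℝ ∞ g (ψ y) := (contMDiffAt_iff_chart hy le_rfl).1 hf
  have hg' : DifferentiableAt ℝ (fderiv ℝ g) (ψ y) :=
    (hgs.fderiv_right (m := ∞) (by norm_cast)).differentiableAt (by simp)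
  have hfd : ∀ᶠ z in 𝓝 y, MDifferentiableAt 𝓘(ℝ, E) 𝓘(ℝ, H) f z := by
    have h1 : ContMDiffAt 𝓘(ℝ, E) 𝓘(ℝ, H) 1 f y := hf.of_le (by norm_cast)
    filter_upwards [(contMDiffAt_iff_contMDiffAt_nhds (by simp)).1 h1] with z hz using hz.mdifferentiableAt (by simp)
  have key : ∀ Y Z : ∀ z : X, TangentSpace 𝓘(ℝ, E) z,
      MDifferentiableAt 𝓘(ℝ, E) 𝓘(ℝ, E).tangent
        (fun z => (⟨z, Z z⟩ : TangentBundle 𝓘(ℝ, E) X)) y →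
      mvfderiv 𝓘(ℝ, E) (fun z => mvfderiv 𝓘(ℝ, E) f z (Z z)) y (Y y) =
        fderiv ℝ (fderiv ℝ g) (ψ y) (fieldCoord y Y (ψ y)) (fieldCoord y Z (ψ y)) +
        fderiv ℝ g (ψ y) (fderiv ℝ (fieldCoord y Z) (ψ y) (fieldCoord y Y (ψ y))) := by
    intro Y Z hZ
    have h1 : ∀ᶠ z in 𝓝 y, mvfderiv 𝓘(ℝ, E) f z (Z z) =
        fderiv ℝ g (ψ z) (fieldCoord y Z (ψ z)) := by
      filter_upwards [hfd, (isOpen_extChartAt_source y).mem_nhds hy] with z hz hzs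
      rw [mvfderiv_eq_fderiv_chart hzs hz, fieldCoord_extChartAt hzs]
    have h2 := hg'.hasFDerivAt.clm_apply (differentiableAt_fieldCoord hZ).hasFDerivAt
    rw [mvfderiv_congr h1, mvfderiv_comp_extChartAt
      (f := fun p => fderiv ℝ g p (fieldCoord y Z p)) hy h2.differentiableAt, h2.fderiv,
      ← fieldCoord_extChartAt hy]
    simp [add_comm, ContinuousLinearMap.comp_apply]
    rfl
  rw [key Y Z hZ, key Z Y hY, mvfderiv_eq_fderiv_chart hy hfd.self_of_nhds,
    chartDeriv_mlieBracket, lieBracket, map_sub]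
  have hsymm := hgs.isSymmSndFDerivAt
    (by simp only [minSmoothness_of_isRCLikeNormedField]; norm_cast)
  rw [hsymm.eq]
  abel

end Commutator

/-! ### Flat connections from locally constant transition functions -/

namespace SmoothVB

open Set Topology VectorField

variable {d : ℕ} {X : Type u} [TopologicalSpace X]
    [ChartedSpace (EuclideanSpace ℝ (Fin d)) X] [IsManifold (𝓡 d) ∞ X]

/-- The transition functions between the preferred trivializations are locally constant. -/
def IsLocallyConstant (E : SmoothVB.{u, v} d X) : Prop :=
  ∀ c c' y, y ∈ (E.localTrivAt c).U → y ∈ (E.localTrivAt c').U → ∀ᶠ z in 𝓝 y, ∀ u,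
    (E.localTrivAt c').T z (((E.localTrivAt c).T z).symm u) =
      (E.localTrivAt c').T y (((E.localTrivAt c).T y).symm u)

variable {E : SmoothVB.{u, v} d X} (hE : E.IsLocallyConstant)

/-- The covariant derivative for which all preferred trivializations are parallel. -/
noncomputable def flatNabla (E : SmoothVB.{u, v} d X) :
    CovariantDerivative (𝓡 d) E.model E.fiber where
  toFun σ y := (E.localTrivAt y).flatCov σ y
  isCovariantDerivativeOnUniv :=
    { add := fun {_ _ y} hσ hσ' _ => (E.localTrivAt y).isCovariantDerivativeOn_flatCov.add hσ hσ'
        (E.mem_localTrivAt y)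
      leibniz := fun {_ _ y} hσ hg _ =>
        (E.localTrivAt y).isCovariantDerivativeOn_flatCov.leibniz hσ hg (E.mem_localTrivAt y) }

include hE

/-- `flatNabla` uses at each point the frame centred there. Near `y` any other preferred frame
differs from that one by a constant matrix, which commutes with differentiation. -/
theorem IsLocallyConstant.T_flatNabla {c y : X} (hy : y ∈ (E.localTrivAt c).U)
    {σ : ∀ y, E.fiber y} (hσ : MDifferentiableAt (𝓡 d) ((𝓡 d).prod 𝓘(ℝ, E.model))
      (fun z => (⟨z, σ z⟩ : E.Total)) y) (v : TangentSpace (𝓡 d) y) :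
    (E.localTrivAt c).T y (E.flatNabla σ y v) =
      mvfderiv (𝓡 d) (fun z => (E.localTrivAt c).T z (σ z)) y v := by
  set t := E.localTrivAt c
  set t' := E.localTrivAt y with ht'
  let M : E.model →L[ℝ] E.model := (t.T y : E.fiber y →L[ℝ] E.model) ∘L
    ((t'.T y).symm : E.model →L[ℝ] E.fiber y)
  have h1 : ∀ᶠ z in 𝓝 y, t.T z (σ z) = M (t'.T z (σ z)) := by
    filter_upwards [hE y c y (E.mem_localTrivAt y) hy] with z hz
    have h := hz (t'.T z (σ z))
    rw [ContinuousLinearEquiv.symm_apply_apply] at h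
    exact h
  rw [mvfderiv_congr h1, mvfderiv_clm_comp M
    ((t'.mdifferentiableAt_section_iff (E.mem_localTrivAt y)).1 hσ)]
  rfl

/-- By `T_flatNabla` the single frame at `y` computes the connection at all nearby points, where it
becomes the derivative of a smooth coordinate function. -/
theorem IsLocallyConstant.contMDiff_flatNabla :
    CovariantDerivative.ContMDiffCovariantDerivative E.flatNabla ∞ := by
  refine ⟨⟨fun {σ} hσ => ?_⟩⟩
  rw [contMDiffOn_univ] at hσ ⊢
  have hσ : E.IsSmoothSection σ := hσ
  intro y
  refine (contMDiffAt_hom_bundle _).2 ⟨contMDiffAt_id, ?_⟩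
  have hf : ContMDiffAt (𝓡 d) 𝓘(ℝ, E.model) ∞ (fun z => (E.localTrivAt y).T z (σ z)) y :=
    ((E.localTrivAt y).contMDiffAt_section_iff (E.mem_localTrivAt y) le_rfl).1 (hσ y)
  have h1 := hf.mfderiv_const (m := ∞) (by norm_cast)
  refine h1.congr_of_eventuallyEq ?_
  filter_upwards [(E.localTrivAt y).isOpen_U.mem_nhds (E.mem_localTrivAt y)] with z hz
  ext w
  simp only [ContinuousLinearMap.inCoordinates, inTangentCoordinates,
    ContinuousLinearMap.comp_apply, TangentBundle.continuousLinearMapAt_model_space]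
  have h2 := hE.T_flatNabla hz ((hσ z).mdifferentiableAt (by simp))
    ((trivializationAt (EuclideanSpace ℝ (Fin d)) (TangentSpace (𝓡 d)) y).symmL ℝ z w)
  have hz' : z ∈ (trivializationAt E.model E.fiber y).baseSet := hz
  rw [Trivialization.continuousLinearMapAt_apply, Trivialization.linearMapAt_apply, if_pos hz']
  rw [localTrivAt, LocalTriv.ofTrivialization_T_apply _ _ hz'] at h2
  exact congrArg (fun u : E.model => u _) h2

theorem IsLocallyConstant.isSmoothSection_flatNabla {σ : ∀ y, E.fiber y}
    (hσ : E.IsSmoothSection σ) {Y : ∀ y : X, TangentSpace (𝓡 d) y} (hY : IsSmoothVectorField Y) :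
    E.IsSmoothSection (fun z => E.flatNabla σ z (Y z)) := by
  have h1 := hE.contMDiff_flatNabla.contMDiff.contMDiff (σ := σ) (hσ.contMDiffOn)
  rw [contMDiffOn_univ] at h1
  exact ContMDiff.clm_bundle_apply h1 hY

/-- In one fixed frame the curvature becomes `Y Z f - Z Y f - [Y, Z] f` for a vector-valued function
`f`. -/
theorem IsLocallyConstant.isFlat_flatNabla : E.IsFlat E.flatNabla := by
  intro Y Z hY hZ σ hσ y
  have hy := E.mem_localTrivAt y
  have key : ∀ Y Z : ∀ y : X, TangentSpace (𝓡 d) y, IsSmoothVectorField Z →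
      (E.localTrivAt y).T y (E.flatNabla (fun z => E.flatNabla σ z (Z z)) y (Y y)) =
      mvfderiv (𝓡 d) (fun z => mvfderiv (𝓡 d) (fun z => (E.localTrivAt y).T z (σ z)) z (Z z))
        y (Y y) := by
    intro Y Z hZ
    rw [hE.T_flatNabla hy ((hE.isSmoothSection_flatNabla hσ hZ y).mdifferentiableAt (by simp))]
    congr 1
    refine mvfderiv_congr ?_
    filter_upwards [(E.localTrivAt y).isOpen_U.mem_nhds hy] with z hz
    exact hE.T_flatNabla hz ((hσ z).mdifferentiableAt (by simp)) _
  apply ((E.localTrivAt y).T y).injective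
  have hf : ContMDiffAt (𝓡 d) 𝓘(ℝ, E.model) ∞ (fun z => (E.localTrivAt y).T z (σ z)) y :=
    ((E.localTrivAt y).contMDiffAt_section_iff (E.mem_localTrivAt y) le_rfl).1 (hσ y)
  have hYd := (hY y).mdifferentiableAt (by simp)
  have hZd := (hZ y).mdifferentiableAt (by simp)
  rw [map_sub, map_sub, key Y Z hZ, key Z Y hY, map_zero, mvfderiv_mvfderiv_sub hf hYd hZd,
    hE.T_flatNabla hy ((hσ y).mdifferentiableAt (by simp)), sub_self]

/-- The flat bundle defined by a bundle with locally constant transition functions. -/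
noncomputable def IsLocallyConstant.toFlatVB : FlatVB.{u, v} d X where
  bundle := E
  nabla := E.flatNabla
  smooth := hE.contMDiff_flatNabla
  flat := hE.isFlat_flatNabla

theorem IsLocallyConstant.isFlatTriv (c : X) : hE.toFlatVB.IsFlatTriv (E.localTrivAt c) :=
  fun _ _ hy hσ v => hE.T_flatNabla hy hσ v

end SmoothVB

/-! ### The flat bundle of a local system -/

namespace LocalSystem

open Set Topology

variable {d : ℕ} {X : Type u} [TopologicalSpace X] [ChartedSpace (EuclideanSpace ℝ (Fin d)) X]
    {n : ℕ} {V : X → Type v} [∀ y, AddCommGroup (V y)] [∀ y, Module ℝ (V y)]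
    (S : LocalSystem X (EuclideanSpace ℝ (Fin n)) V)

/-- The trivialization of a local system as a trivialization of its total space. -/
def pretriv (c : X) : Pretrivialization (EuclideanSpace ℝ (Fin n))
    (π (EuclideanSpace ℝ (Fin n)) V) where
  toFun p := (p.1, S.T c p.1 p.2)
  invFun q := ⟨q.1, (S.T c q.1).symm q.2⟩
  source := π (EuclideanSpace ℝ (Fin n)) V ⁻¹' S.U c
  target := S.U c ×ˢ univ
  map_source' _ hp := ⟨hp, mem_univ _⟩
  map_target' _ hq := hq.1
  left_inv' p _ := by simp
  right_inv' q _ := by simp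
  open_target := (S.isOpen_U c).prod isOpen_univ
  baseSet := S.U c
  open_baseSet := S.isOpen_U c
  source_eq := rfl
  target_eq := rfl
  proj_toFun _ _ := rfl

/-- The transition functions of a local system. -/
noncomputable def transition (c c' y : X) :
    EuclideanSpace ℝ (Fin n) →L[ℝ] EuclideanSpace ℝ (Fin n) :=
  LinearMap.toContinuousLinearMap ((S.T c' y).toLinearMap ∘ₗ (S.T c y).symm.toLinearMap)

theorem contMDiffOn_transition (c c' : X) :
    ContMDiffOn (𝓡 d) 𝓘(ℝ, EuclideanSpace ℝ (Fin n) →L[ℝ] EuclideanSpace ℝ (Fin n)) ∞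
      (S.transition c c') (S.U c ∩ S.U c') := by
  rintro y ⟨hy, hy'⟩
  refine ContMDiffAt.contMDiffWithinAt ?_
  refine (contMDiffAt_const (c := S.transition c c' y)).congr_of_eventuallyEq ?_
  filter_upwards [S.locConst c c' y hy hy'] with z hz
  ext1 u
  exact hz u

theorem transition_apply {c c' y : X} (hy : y ∈ S.U c) (u : EuclideanSpace ℝ (Fin n)) :
    S.transition c c' y u = (S.pretriv c' ⟨y, (S.pretriv c).symm y u⟩).2 := by
  rw [(S.pretriv c).mk_symm hy]
  rfl

variable [∀ y, TopologicalSpace (V y)] [∀ y, IsTopologicalAddGroup (V y)]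
    [∀ y, ContinuousSMul ℝ (V y)] [∀ y, IsModuleTopology ℝ (V y)]

/-- The vector prebundle of a local system. -/
noncomputable def prebundle (d : ℕ) [ChartedSpace (EuclideanSpace ℝ (Fin d)) X] :
    VectorPrebundle ℝ (EuclideanSpace ℝ (Fin n)) V where
  pretrivializationAtlas := range S.pretriv
  pretrivialization_linear' := by
    rintro _ ⟨c, rfl⟩
    exact ⟨fun y _ => ⟨fun a b => map_add (S.T c y) a b, fun r a => map_smul (S.T c y) r a⟩⟩
  pretrivializationAt := S.pretriv
  mem_base_pretrivializationAt := S.mem_U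
  pretrivialization_mem_atlas c := ⟨c, rfl⟩
  exists_coordChange := by
    rintro _ ⟨c, rfl⟩ _ ⟨c', rfl⟩
    exact ⟨S.transition c c', (S.contMDiffOn_transition (d := d) c c').continuousOn,
      fun y hy u => S.transition_apply hy.1 u⟩
  totalSpaceMk_isInducing y := by
    -- The module topology on the fibre makes the linear isomorphism `S.T y y` a homeomorphism.
    let L : V y ≃L[ℝ] EuclideanSpace ℝ (Fin n) :=
      { S.T y y with
        continuous_toFun := IsModuleTopology.continuous_of_linearMap (S.T y y).toLinearMap
        continuous_invFun := LinearMap.continuous_of_finiteDimensional (S.T y y).symm.toLinearMap }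
    have h1 : IsInducing (fun u : EuclideanSpace ℝ (Fin n) => (y, u)) :=
      (isEmbedding_prodMkRight y).isInducing
    exact h1.comp L.toHomeomorph.isInducing

theorem isContMDiff_prebundle : (S.prebundle d).IsContMDiff (𝓡 d) ∞ := by
  refine ⟨?_⟩
  rintro _ ⟨c, rfl⟩ _ ⟨c', rfl⟩
  exact ⟨S.transition c c', S.contMDiffOn_transition (d := d) c c',
    fun y hy u => S.transition_apply hy.1 u⟩

variable [IsManifold (𝓡 d) ∞ X]

/-- The vector bundle of a local system. -/
noncomputable def toSmoothVB (d : ℕ) [ChartedSpace (EuclideanSpace ℝ (Fin d)) X]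
    [IsManifold (𝓡 d) ∞ X] : SmoothVB.{u, v} d X :=
  letI := (S.prebundle d).totalSpaceTopology
  letI := (S.prebundle d).toFiberBundle
  haveI := (S.prebundle d).toVectorBundle
  haveI := S.isContMDiff_prebundle (d := d)
  { rank := n
    fiber := V
    smoothBundle := VectorPrebundle.contMDiffVectorBundle (IB := 𝓡 d) (n := ∞) (S.prebundle d) }

theorem localTrivAt_T {c y : X} (hy : y ∈ S.U c) (a : V y) :
    ((S.toSmoothVB d).localTrivAt c).T y a = S.T c y a :=
  SmoothVB.LocalTriv.ofTrivialization_T_apply (S.toSmoothVB d) _ (y := y) hy a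

theorem localTrivAt_T_symm {c y : X} (hy : y ∈ S.U c) (u : EuclideanSpace ℝ (Fin n)) :
    (((S.toSmoothVB d).localTrivAt c).T y).symm u = (S.T c y).symm u := by
  exact (ContinuousLinearEquiv.symm_apply_eq _).2
    (((S.T c y).apply_symm_apply u).symm.trans (S.localTrivAt_T (d := d) hy _).symm)

theorem isLocallyConstant : (S.toSmoothVB d).IsLocallyConstant := by
  intro c c' y hy hy'
  filter_upwards [S.locConst c c' y hy hy', (S.isOpen_U c).mem_nhds hy,
    (S.isOpen_U c').mem_nhds hy'] with z hz hzc hzc' u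
  have key : ∀ z ∈ S.U c, z ∈ S.U c' → ((S.toSmoothVB d).localTrivAt c').T z
      ((((S.toSmoothVB d).localTrivAt c).T z).symm u) = S.T c' z ((S.T c z).symm u) := by
    intro z hzc hzc'
    exact (congrArg (((S.toSmoothVB d).localTrivAt c').T z)
      (S.localTrivAt_T_symm (d := d) hzc u)).trans (S.localTrivAt_T (d := d) hzc' _)
  exact (key z hzc hzc').trans ((hz u).trans (key y hy hy').symm)

/-- The flat vector bundle of a local system. -/
noncomputable def toFlatVB (d : ℕ) [ChartedSpace (EuclideanSpace ℝ (Fin d)) X]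
    [IsManifold (𝓡 d) ∞ X] : FlatVB.{u, v} d X :=
  (S.isLocallyConstant (d := d)).toFlatVB

/-- The parallel transport of the flat bundle of a local system is that of the local system. -/
theorem transport_toFlatVB [T2Space X] {y z : X} (γ : Path.Homotopic.Quotient y z) (a : V y) :
    (S.toFlatVB d).localSystem.transport γ a = S.transport γ a := by
  -- The original trivializations are flat, so the identity is a morphism to the local system of
  -- chosen parallel frames, and morphisms commute with transport.
  have h : S.IsMorphism (S.toFlatVB d).localSystem (fun y => (LinearMap.id : V y →ₗ[ℝ] V y)) := by
    intro c c' y hy hy'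
    have h1 := FlatVB.eventually_hom_eq (𝟙 (S.toFlatVB d))
      ((S.isLocallyConstant (d := d)).isFlatTriv c)
      ((S.toFlatVB d).isFlatTriv_flatTriv c') hy hy'
    filter_upwards [h1, (S.isOpen_U c).mem_nhds hy] with z hz hzc u
    have h2 : ∀ z ∈ S.U c, (((S.toFlatVB d).flatTriv c').T z) ((S.T c z).symm u) =
        ((S.toFlatVB d).flatTriv c').T z ((((S.toSmoothVB d).localTrivAt c).T z).symm u) :=
      fun z hz => congrArg (((S.toFlatVB d).flatTriv c').T z)
        (S.localTrivAt_T_symm (d := d) hz u).symm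
    exact (h2 z hzc).trans ((hz u).trans (h2 y hy).symm)
  exact (h.transport γ a).symm

end LocalSystem

/-! ### Local systems from representations of the fundamental group -/

section PathRep

open Set Topology

/-- A point of a manifold has a simply connected open neighbourhood. -/
theorem exists_simplyConnected_nhd {E : Type*} [NormedAddCommGroup E] [NormedSpace ℝ E]
    {X : Type*} [TopologicalSpace X] [ChartedSpace E X] (c : X) :
    ∃ U : Set X, IsOpen U ∧ c ∈ U ∧ SimplyConnectedSpace U := by
  set e := chartAt E c with he
  obtain ⟨r, hr, hball⟩ := Metric.isOpen_iff.1 e.open_target (e c)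
    (e.map_source (mem_chart_source E c))
  have hb : Metric.ball (e c) r ⊆ e.symm.source := hball
  refine ⟨e.symm '' Metric.ball (e c) r, e.symm.isOpen_image_of_subset_source Metric.isOpen_ball hb,
    ⟨e c, Metric.mem_ball_self hr, e.left_inv (mem_chart_source E c)⟩, ?_⟩
  have := Metric.contractibleSpace_ball (x := e c) hr
  have := (e.symm.homeomorphOfImageSubsetSource hb rfl).symm.contractibleSpace
  infer_instance

variable {X : Type*} [TopologicalSpace X]

theorem Path.homotopic_of_range_subset {U : Set X} [SimplyConnectedSpace U] {y z : X}
    (γ γ' : Path y z) (h : range γ ⊆ U) (h' : range γ' ⊆ U) : γ.Homotopic γ' := by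
  have hy : y ∈ U := h ⟨0, γ.source⟩
  have hz : z ∈ U := h ⟨1, γ.target⟩
  let lift : ∀ γ : Path y z, range γ ⊆ U → Path (⟨y, hy⟩ : U) ⟨z, hz⟩ := fun γ h =>
    { toFun := fun t => ⟨γ t, h ⟨t, rfl⟩⟩
      continuous_toFun := by fun_prop
      source' := Subtype.ext γ.source
      target' := Subtype.ext γ.target }
  have h1 := (SimplyConnectedSpace.paths_homotopic (lift γ h) (lift γ' h')).map
    (⟨Subtype.val, continuous_subtype_val⟩ : C(U, X))
  exact h1

/-- A representation of the fundamental groupoid on a constant family of vector spaces. -/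
structure PathRep (X : Type*) [TopologicalSpace X] (W : Type*) [AddCommGroup W] [Module ℝ W] where
  /-- The linear map attached to a homotopy class of paths. -/
  map : ∀ {y z : X}, Path.Homotopic.Quotient y z → W →ₗ[ℝ] W
  map_refl : ∀ (y : X) a, map (.refl y) a = a
  map_trans : ∀ {y z w : X} (γ : Path.Homotopic.Quotient y z) (γ' : Path.Homotopic.Quotient z w) a,
    map (γ.trans γ') a = map γ' (map γ a)

namespace PathRep

variable {W : Type*} [AddCommGroup W] [Module ℝ W] (P : PathRep X W)

/-- The linear isomorphism attached to a homotopy class of paths. -/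
def equiv {y z : X} (γ : Path.Homotopic.Quotient y z) : W ≃ₗ[ℝ] W :=
  { P.map γ with
    invFun := P.map γ.symm
    left_inv := fun a => by
      change P.map γ.symm (P.map γ a) = a
      rw [← P.map_trans, Path.Homotopic.Quotient.trans_symm, P.map_refl]
    right_inv := fun a => by
      change P.map γ (P.map γ.symm a) = a
      rw [← P.map_trans, Path.Homotopic.Quotient.symm_trans, P.map_refl] }

theorem equiv_apply {y z : X} (γ : Path.Homotopic.Quotient y z) (a : W) :
    P.equiv γ a = P.map γ a := rfl

variable {F : Type*} [AddCommGroup F] [Module ℝ F] (L : W ≃ₗ[ℝ] F) {U : X → Set X}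
  (hmem : ∀ c, c ∈ U c) (hsc : ∀ c, SimplyConnectedSpace (U c))

theorem exists_path_in (c : X) {y : X} (hy : y ∈ U c) (hc : c ∈ U c)
    (hsc : SimplyConnectedSpace (U c)) : ∃ γ : Path y c, range γ ⊆ U c := by
  refine ⟨(PathConnectedSpace.somePath (⟨y, hy⟩ : U c) ⟨c, hc⟩).map continuous_subtype_val, ?_⟩
  rintro _ ⟨t, rfl⟩
  exact Subtype.coe_prop _

open Classical in
/-- The trivialization around `c` obtained by transport to `c`. -/
noncomputable def triv (c y : X) : W ≃ₗ[ℝ] F :=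
  if h : y ∈ U c then
    (P.equiv (.mk (exists_path_in c h (hmem c) (hsc c)).choose)).trans L
  else L

/-- Following `γ` and then the chosen path from `z` to `c` gives a path inside the simply connected
`U c`, hence homotopic to the chosen path from `y` to `c`. -/
theorem triv_map {c y z : X} (γ : Path y z) (h : range γ ⊆ U c) (a : W) :
    P.triv L hmem hsc c z (P.map (.mk γ) a) = P.triv L hmem hsc c y a := by
  have hy : y ∈ U c := h ⟨0, γ.source⟩
  have hz : z ∈ U c := h ⟨1, γ.target⟩
  simp only [triv, hy, hz, dif_pos, LinearEquiv.trans_apply, equiv_apply]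
  rw [← P.map_trans, ← Path.Homotopic.Quotient.mk_trans]
  have := hsc c
  rw [Path.Homotopic.Quotient.eq.2 (Path.homotopic_of_range_subset (U := U c) _
    (exists_path_in c hy (hmem c) (hsc c)).choose ?_
      (exists_path_in c hy (hmem c) (hsc c)).choose_spec)]
  rw [Path.trans_range]
  exact union_subset h (exists_path_in c hz (hmem c) (hsc c)).choose_spec

/-- The local system of a representation of the fundamental groupoid. -/
noncomputable def localSystem [LocallyPathConnectedSpace X] (hU : ∀ c, IsOpen (U c)) :
    LocalSystem X F (fun _ => W) where
  U := U
  isOpen_U := hU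
  mem_U := hmem
  T := P.triv L hmem hsc
  locConst c c' y hy hy' := by
    -- A path from `y` to `z` inside both domains changes neither trivialization, by `triv_map`, so
    -- the transition map is the same at `z` as at `y`.
    obtain ⟨N, ⟨hN, hNp⟩, hNs⟩ := (path_connected_basis y).mem_iff.1
      (((hU c).inter (hU c')).mem_nhds ⟨hy, hy'⟩)
    filter_upwards [hN] with z hz u
    obtain ⟨γ, hγ⟩ := hNp.joinedIn y (mem_of_mem_nhds hN) z hz
    have hr : range γ ⊆ U c ∩ U c' := by
      rintro _ ⟨t, rfl⟩
      exact hNs (hγ t)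
    have h1 := P.triv_map L hmem hsc γ (hr.trans inter_subset_left)
      ((P.triv L hmem hsc c y).symm u)
    rw [LinearEquiv.apply_symm_apply, ← LinearEquiv.eq_symm_apply] at h1
    rw [← h1, P.triv_map L hmem hsc γ (hr.trans inter_subset_right)]

theorem transport_localSystem [LocallyPathConnectedSpace X] (hU : ∀ c, IsOpen (U c)) {y z : X}
    (γ : Path.Homotopic.Quotient y z) (a : W) :
    (P.localSystem L hmem hsc hU).transport γ a = P.map γ a := by
  revert a
  refine Path.Homotopic.Quotient.induction_of_cover hU hmem
    (P := fun {y z} γ => ∀ a, (P.localSystem L hmem hsc hU).transport γ a = P.map γ a) ?_ ?_ γ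
  · intro y z w p q hp hq a
    rw [LocalSystem.transport_trans, hp, hq, P.map_trans]
  · intro c y z γ hγ a
    rw [LocalSystem.transport_mk_of_subset _ γ hγ]
    exact (LinearEquiv.symm_apply_eq _).2 (P.triv_map L hmem hsc γ hγ a).symm

end PathRep

/-- Every finite-dimensional representation of the fundamental groupoid is the parallel transport
of a flat vector bundle. -/
theorem exists_flatVB_of_pathRep {d : ℕ} {X : Type u} [TopologicalSpace X]
    [ChartedSpace (EuclideanSpace ℝ (Fin d)) X] [IsManifold (𝓡 d) ∞ X] [T2Space X]
    {W : Type v} [AddCommGroup W] [Module ℝ W] [FiniteDimensional ℝ W] (P : PathRep X W) :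
    ∃ (E : FlatVB.{u, v} d X) (f : ∀ y, E.bundle.fiber y ≃ₗ[ℝ] W),
      ∀ {y z : X} (γ : Path.Homotopic.Quotient y z) (a : E.bundle.fiber y),
        f z (E.localSystem.transport γ a) = P.map γ (f y a) := by
  have := ChartedSpace.locallyPathConnectedSpace (EuclideanSpace ℝ (Fin d)) X
  choose U hU hmem hsc using exists_simplyConnected_nhd (E := EuclideanSpace ℝ (Fin d)) (X := X)
  have L : W ≃ₗ[ℝ] EuclideanSpace ℝ (Fin (Module.finrank ℝ W)) :=
    LinearEquiv.ofFinrankEq _ _ (by simp)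
  -- `W` is purely algebraic; the fibres need the vector space topology. All fibres are copies of
  -- `W`, with the twisting carried by the trivializations, so `f` can be the identity.
  let : TopologicalSpace W := moduleTopology ℝ W
  have : IsModuleTopology ℝ W := ⟨rfl⟩
  have : IsTopologicalAddGroup W := IsModuleTopology.topologicalAddGroup ℝ W
  have : ContinuousSMul ℝ W := IsModuleTopology.toContinuousSMul ℝ W
  refine ⟨(P.localSystem L hmem hsc hU).toFlatVB d, fun y => LinearEquiv.refl ℝ W, ?_⟩
  intro y z γ a
  exact ((P.localSystem L hmem hsc hU).transport_toFlatVB γ a).trans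
    (P.transport_localSystem L hmem hsc hU γ a)

end PathRep

/-! ### The monodromy functor -/

section LoopAction

variable {X : Type u} [TopologicalSpace X]

/-- The action of a loop in a representation of the fundamental group. -/
noncomputable def loopAction {x : X} (A : Action (FGModuleCat.{v} ℝ) (FundamentalGroup X x))
    (γ : Path.Homotopic.Quotient x x) : A.V →ₗ[ℝ] A.V :=
  (A.ρ (FundamentalGroup.fromPath γ)).hom.hom

theorem loopAction_refl {x : X} (A : Action (FGModuleCat.{v} ℝ) (FundamentalGroup X x)) (a : A.V) :
    loopAction A (.refl x) a = a :=
  LinearMap.congr_fun (congrArg (fun f => f.hom.hom) (A.ρ.map_one)) a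

/-- Products in the fundamental group and in endomorphisms both compose from right to left, so no
inverse or opposite group appears. -/
theorem loopAction_trans {x : X} (A : Action (FGModuleCat.{v} ℝ) (FundamentalGroup X x))
    (γ γ' : Path.Homotopic.Quotient x x) (a : A.V) :
    loopAction A (γ.trans γ') a = loopAction A γ' (loopAction A γ a) :=
  LinearMap.congr_fun (congrArg (fun f => f.hom.hom)
    (A.ρ.map_mul (FundamentalGroup.fromPath γ') (FundamentalGroup.fromPath γ))) a

/-- The representation of the fundamental groupoid defined by a representation of the fundamental
group and a choice of paths from the base point. -/
noncomputable def loopAction.pathRep {x : X} (A : Action (FGModuleCat.{v} ℝ) (FundamentalGroup X x))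
    (p : ∀ y, Path.Homotopic.Quotient x y) : PathRep X A.V where
  -- The chosen paths from `x` close `γ` up to a loop at `x`.
  map {y z} γ := loopAction A (((p y).trans γ).trans (p z).symm)
  map_refl y a := by
    rw [Path.Homotopic.Quotient.trans_refl, Path.Homotopic.Quotient.trans_symm, loopAction_refl]
  map_trans {y z w} γ γ' a := by
    rw [← loopAction_trans]
    congr 1
    simp only [Path.Homotopic.Quotient.trans_assoc]
    rw [← Path.Homotopic.Quotient.trans_assoc (p z).symm, Path.Homotopic.Quotient.symm_trans,
      Path.Homotopic.Quotient.refl_trans]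

end LoopAction

theorem pathConnectedSpace_of_chartedSpace (d : ℕ) (X : Type*) [TopologicalSpace X]
    [ChartedSpace (EuclideanSpace ℝ (Fin d)) X] [ConnectedSpace X] : PathConnectedSpace X := by
  have := ChartedSpace.locallyPathConnectedSpace (EuclideanSpace ℝ (Fin d)) X
  exact pathConnectedSpace_iff_connectedSpace.2 inferInstance

section Monodromy

open Set Topology

variable {d : ℕ} {X : Type u} [TopologicalSpace X]
    [ChartedSpace (EuclideanSpace ℝ (Fin d)) X] [IsManifold (𝓡 d) ∞ X]

instance (E : SmoothVB.{u, v} d X) (y : X) : Module.Finite ℝ (E.fiber y) :=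
  .equiv (E.fiberEquiv y).symm.toLinearEquiv

variable [T2Space X] (x : X)

namespace FlatVB

/-- The monodromy representation of a flat vector bundle. -/
noncomputable def monodromyObj (E : FlatVB.{u, v} d X) :
    Action (FGModuleCat.{v} ℝ) (FundamentalGroup X x) where
  V := FGModuleCat.of ℝ (E.bundle.fiber x)
  ρ :=
    { toFun := fun g => FGModuleCat.ofHom (E.localSystem.transport (FundamentalGroup.toPath g))
      map_one' := by
        refine FGModuleCat.hom_ext (LinearMap.ext fun a => ?_)
        exact E.localSystem.transport_refl x a
      map_mul' := fun g h => by
        refine FGModuleCat.hom_ext (LinearMap.ext fun a => ?_)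
        exact E.localSystem.transport_trans (FundamentalGroup.toPath h)
          (FundamentalGroup.toPath g) a }

variable (d X) in
/-- The monodromy functor. -/
noncomputable def monodromy :
    FlatVB.{u, v} d X ⥤ Action (FGModuleCat.{v} ℝ) (FundamentalGroup X x) where
  obj E := E.monodromyObj x
  map {E E'} φ :=
    { hom := FGModuleCat.ofHom (φ.hom.app x).toLinearMap
      comm := fun g => by
        refine FGModuleCat.hom_ext (LinearMap.ext fun a => ?_)
        exact (isMorphism_hom φ).transport (FundamentalGroup.toPath g) a }
  map_id _ := rfl
  map_comp _ _ := rfl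

variable [ConnectedSpace X]

/-- Every vector over `y` is transported from a vector over `x`, and morphisms commute with
transport, so the fibre map at `x` determines the morphism. -/
instance : (monodromy.{u, v} d X x).Faithful where
  map_injective {E E'} φ φ' h := by
    have := pathConnectedSpace_of_chartedSpace d X
    have hx : ∀ a, φ.hom.app x a = φ'.hom.app x a := fun a =>
      LinearMap.congr_fun (congrArg (fun f => f.hom.hom.hom) h) a
    refine FlatVB.Hom.ext (SmoothVB.Hom.ext (funext fun y => ?_))
    ext a
    have γ : Path.Homotopic.Quotient x y := .mk (PathConnectedSpace.somePath x y)
    rw [← LocalSystem.transport_symm_trans (S := E.localSystem) γ a]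
    have h1 := (isMorphism_hom φ).transport γ (E.localSystem.transport γ.symm a)
    have h2 := (isMorphism_hom φ').transport γ (E.localSystem.transport γ.symm a)
    refine h1.trans (Eq.trans ?_ h2.symm)
    exact congrArg _ (hx _)

/-- An equivariant map on the fibre at `x` spreads out along paths by
`LocalSystem.exists_isMorphism`; the resulting family is smooth and parallel by `homOfIsMorphism`.
-/
instance : (monodromy.{u, v} d X x).Full where
  map_surjective {E E'} f := by
    have := ChartedSpace.locallyPathConnectedSpace (EuclideanSpace ℝ (Fin d)) X
    have := pathConnectedSpace_of_chartedSpace d X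
    obtain ⟨φ, hφ, hx⟩ := LocalSystem.exists_isMorphism (S := E.localSystem)
      (S' := E'.localSystem) (x := x) f.hom.hom.hom fun γ a =>
        LinearMap.congr_fun (congrArg (fun f => f.hom.hom)
          (f.comm (FundamentalGroup.fromPath γ))) a
    refine ⟨homOfIsMorphism φ hφ, ?_⟩
    refine Action.hom_ext _ _ (FGModuleCat.hom_ext (LinearMap.ext fun a => ?_))
    exact (homOfIsMorphism_app φ hφ x a).trans (LinearMap.congr_fun hx a)

end FlatVB

instance FlatVB.essSurj_monodromy [ConnectedSpace X] : (monodromy.{u, v} d X x).EssSurj where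
  mem_essImage A := by
    have := pathConnectedSpace_of_chartedSpace d X
    let p : ∀ y, Path.Homotopic.Quotient x y := fun y => .mk (PathConnectedSpace.somePath x y)
    obtain ⟨E, f, hf⟩ := exists_flatVB_of_pathRep (d := d) (loopAction.pathRep A p)
    -- The chosen path `p x` may be a nontrivial loop, so `f x` intertwines the monodromy only with
    -- a conjugate of `A`; composing with the action of `p x` undoes the conjugation.
    let e : FGModuleCat.of ℝ (E.bundle.fiber x) ≅ A.V :=
      (f x).toFGModuleCatIso ≪≫ A.ρAut (FundamentalGroup.fromPath (p x))
    refine ⟨E, ⟨Action.mkIso e fun g => ?_⟩⟩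
    refine FGModuleCat.hom_ext (LinearMap.ext fun a => ?_)
    have h1 := hf (FundamentalGroup.toPath g) a
    have h2 : loopAction A (p x) (f x (E.localSystem.transport (FundamentalGroup.toPath g) a)) =
        loopAction A (FundamentalGroup.toPath g) (loopAction A (p x) (f x a)) := by
      rw [h1, ← loopAction_trans]
      change loopAction A (p x) (loopAction A _ (f x a)) = _
      rw [← loopAction_trans, Path.Homotopic.Quotient.trans_assoc,
        Path.Homotopic.Quotient.symm_trans, Path.Homotopic.Quotient.trans_refl]
    exact h2

instance [ConnectedSpace X] : (FlatVB.monodromy.{u, v} d X x).IsEquivalence where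

end Monodromy

/-! ### Quiver representations -/

namespace QuiverRep

variable {Q : Type w} [Quiver.{w'} Q] {C : Type*} [Category* C] {D : Type*} [Category* D]

/-- The functor on quiver representations induced by a functor. -/
@[simps]
def mapFunctor (Q : Type w) [Quiver.{w'} Q] (F : C ⥤ D) : QuiverRep Q C ⥤ QuiverRep Q D where
  obj V := { obj := fun i => F.obj (V.obj i), map := fun a => F.map (V.map a) }
  map f :=
    { app := fun i => F.map (f.app i)
      comm := fun a => by rw [← F.map_comp, f.comm, F.map_comp] }
  map_id V := Hom.ext (funext fun i => F.map_id _)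
  map_comp f g := Hom.ext (funext fun i => F.map_comp _ _)

/-- Isomorphisms of quiver representations are constructed vertexwise. -/
@[simps]
def isoMk {V W : QuiverRep Q C} (e : ∀ i, V.obj i ≅ W.obj i)
    (h : ∀ {i j : Q} (a : i ⟶ j), V.map a ≫ (e j).hom = (e i).hom ≫ W.map a) : V ≅ W where
  hom := { app := fun i => (e i).hom, comm := h }
  inv :=
    { app := fun i => (e i).inv
      comm := fun {i j} a => by rw [Iso.comp_inv_eq, Category.assoc, h, Iso.inv_hom_id_assoc] }
  hom_inv_id := Hom.ext (funext fun i => (e i).hom_inv_id)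
  inv_hom_id := Hom.ext (funext fun i => (e i).inv_hom_id)

instance (F : C ⥤ D) [F.Faithful] : (mapFunctor Q F).Faithful where
  map_injective h := Hom.ext (funext fun i =>
    F.map_injective (congrFun (congrArg Hom.app h) i))

/-- Fullness lifts the components and faithfulness reflects the commuting squares. -/
instance (F : C ⥤ D) [F.Full] [F.Faithful] : (mapFunctor Q F).Full where
  map_surjective {V W} f :=
    ⟨{ app := fun i => F.preimage (f.app i)
       comm := fun a => F.map_injective <| (F.map_comp _ _).trans <|
        (congrArg (F.map (V.map a) ≫ ·) (F.map_preimage _)).trans <| (f.comm a).trans <|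
        (congrArg (· ≫ F.map (W.map a)) (F.map_preimage _).symm).trans (F.map_comp _ _).symm },
      Hom.ext (funext fun _ => F.map_preimage _)⟩

/-- Vertices are lifted up to isomorphism; each arrow is conjugated by these isomorphisms and lifted
by fullness. There are no relations between arrows to check. -/
instance (F : C ⥤ D) [F.Full] [F.EssSurj] : (mapFunctor Q F).EssSurj where
  mem_essImage W :=
    ⟨{ obj := fun i => F.objPreimage (W.obj i)
       map := fun {i j} a => F.preimage
        ((F.objObjPreimageIso (W.obj i)).hom ≫ W.map a ≫ (F.objObjPreimageIso (W.obj j)).inv) },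
      ⟨isoMk (fun i => F.objObjPreimageIso (W.obj i)) fun {i j} a =>
        (congrArg (· ≫ (F.objObjPreimageIso (W.obj j)).hom) (F.map_preimage _)).trans <|
        (Category.assoc _ _ _).trans <| congrArg ((F.objObjPreimageIso (W.obj i)).hom ≫ ·) <|
        (Category.assoc _ _ _).trans <|
        (congrArg (W.map a ≫ ·) (Iso.inv_hom_id _)).trans (Category.comp_id _)⟩⟩

instance (F : C ⥤ D) [F.IsEquivalence] : (mapFunctor Q F).IsEquivalence where

/-- Quiver representations in group representations are group representations in quiver
representations. -/
def actionEquivalence (Q : Type w) [Quiver.{w'} Q] (C : Type*) [Category* C] (G : Type*)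
    [Monoid G] : QuiverRep Q (Action C G) ≌ Action (QuiverRep Q C) G where
  functor :=
    { obj := fun V =>
        { V := { obj := fun i => (V.obj i).V, map := fun a => (V.map a).hom }
          ρ :=
            { toFun := fun g =>
                { app := fun i => (V.obj i).ρ g, comm := fun a => ((V.map a).comm g).symm }
              map_one' := Hom.ext (funext fun i => (V.obj i).ρ.map_one)
              map_mul' := fun g h => Hom.ext (funext fun i => (V.obj i).ρ.map_mul g h) } }
      map := fun f =>
        { hom :=
            { app := fun i => (f.app i).hom
              comm := fun a => congrArg Action.Hom.hom (f.comm a) }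
          comm := fun g => Hom.ext (funext fun i => (f.app i).comm g) } }
  inverse :=
    { obj := fun A =>
        { obj := fun i =>
            { V := A.V.obj i
              ρ :=
                { toFun := fun g => (A.ρ g).app i
                  map_one' := congrFun (congrArg Hom.app A.ρ.map_one) i
                  map_mul' := fun g h => congrFun (congrArg Hom.app (A.ρ.map_mul g h)) i } }
          map := fun a => { hom := A.V.map a, comm := fun g => ((A.ρ g).comm a).symm } }
      map := fun f =>
        { app := fun i =>
            { hom := f.hom.app i
              comm := fun g => congrFun (congrArg Hom.app (f.comm g)) i }
          comm := fun a => Action.hom_ext _ _ (f.hom.comm a) } }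
  -- Both composites only regroup the data, so they are identities by definitional unfolding.
  unitIso := Iso.refl _
  counitIso := Iso.refl _
  functor_unitIso_comp _ :=
    Action.hom_ext _ _ (Hom.ext (funext fun _ => Category.comp_id _))

end QuiverRep

theorem mainTheorem8 {d : ℕ} {X : Type u} [TopologicalSpace X]
    [ChartedSpace (EuclideanSpace ℝ (Fin d)) X] [IsManifold (𝓡 d) ∞ X]
    [T2Space X] [SecondCountableTopology X] [ConnectedSpace X] (x : X)
    (Q : Type w) [Quiver.{w'} Q] [Finite Q] [∀ i j : Q, Finite (i ⟶ j)] :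
    Nonempty (QuiverRep Q (FlatVB.{u, v} d X) ≌
      Action (QuiverRep Q (FGModuleCat.{v} ℝ)) (FundamentalGroup X x)) :=
  ⟨(QuiverRep.mapFunctor Q (FlatVB.monodromy.{u, v} d X x)).asEquivalence.trans
    (QuiverRep.actionEquivalence Q (FGModuleCat.{v} ℝ) (FundamentalGroup X x))⟩
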